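/- **Setting.** Let $d\ge 1$, $p\geq 0$, let $\xi$ be a random vector in $\mathbb{R}^p$ with law $P_\xi$, and let $F:\mathbb{R}^d\times\mathbb{R}^p\to\mathbb{R}$ be measurable in $\xi$ for every $w$, continuous in $w$ for every $\xi$, with $F(w,\xi)$ integrable for every $w$, and such that for almost every $\xi$ the function $F(\cdot,\xi)$ is $C(\xi)$-Lipschitz, where $Q:=\mathbb{E}[C(\xi)^2]<\infty$ and $L_0:=\mathbb{E}[C(\xi)]>0$. Let $f(w):=\mathbb{E}_\xi[F(w,\xi)]$, which is assumed to attain its global minimum at some $x^*$, let $x^1\in\mathbb{R}^d$ and $\Delta:=f(x^1)-f(x^*)$. Let $\widetilde\nabla F:\mathbb{R}^d\times\mathbb{R}^p\to\mathbb{R}^d$ be a Borel measurable function that equals the gradient of $F(w,\xi)$ in $w$ for almost every $(w,\xi)$ (with respect to Lebesgue measure times $P_\xi$) at which this gradient exists; one evaluation of $\widetilde\nabla F$ is a *gradient call*. Write $B(\sigma)$ for the closed Euclidean ball of radius $\sigma$ about $0$ and $U(B(\sigma))$ for the uniform distribution on it. Let $\partial f(w)$ be the Clarke subdifferential, i.e.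 the convex hull of all limits $\lim_i\nabla f(w_i)$ with $w_i\to w$ and $f$ differentiable at each $w_i$, and let $\partial_{\epsilon}f(w):=\mathrm{co}\bigcup_{\hat w\in w+B(\epsilon)}\partial f(\hat w)$. A point $w$ is $(\epsilon_1,\epsilon_2)$-*stationary* if $\mathrm{dist}(0,\partial_{\epsilon_1}f(w))\le\epsilon_2$. **PISGD** with parameters $K,S\in\mathbb{Z}_{>0}$ and $\eta,\sigma>0$: draw $R$ uniformly from $\{1,\dots,K\}$; for $k=1,\dots,R-1$ draw $z^k_l\sim U(B(\sigma))$ and $\xi^k_l\sim P_\xi$ for $l=1,\dots,S$, and set $x^{k+1}=x^k-\frac{\eta}{S}\sum_{l=1}^S\widetilde\nabla F(x^k+z^k_l,\xi^k_l)$; output $x^R$. All sampling is independent. **Statement.** Let $c\in(0,1)$ and $\phi>1$ be arbitrary constants. For $\gamma\in(0,1)$ and $\epsilon_1,\epsilon_2>0$ put $$\mathcal{R}=\lceil-\ln(c\gamma)\rceil,\quad \psi=\frac{\mathcal{R}+1}{(1-c)\gamma},\quad T=\left\lceil 6\phi\psi\frac{Q}{\epsilon_2^2}\right\rceil,\quad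 \epsilon_2'=\sqrt{\frac{\epsilon_2^2-6\psi\frac{Q}{T}}{4e}},$$ $$K=\max\left(\left\lfloor\frac{2}{(\epsilon_2')^2}\left(L_0\Delta+Q+\sqrt d L_0^2\right)+1\right\rfloor,\left\lceil\frac{2\sqrt d}{(\epsilon_2')^2}\left(\frac{L_0\Delta+Q}{\epsilon_1}+L_0^2\right)\right\rceil\right),$$ $$\beta=\frac{\log(K(\epsilon_2')^2-2\sqrt d L_0^2)-\log(2(L_0\Delta+Q))}{\log K},$$ $$S=\lceil K^{1-\beta}\rceil,\quad \sigma=\sqrt d\,K^{-\beta},\quad \eta=\frac{1}{L_0}K^{-\beta}$$ (if $K=1$, the value of $\beta$ is irrelevant; put $\beta=0$). Run PISGD from $x^1$ with these parameters $\mathcal{R}$ times independently, with outputs $\overline X=\{\bar x^1,\dots,\bar x^{\mathcal{R}}\}$. Independently draw $T$ independent samples $(z_t,\xi_t)$ with $z_t\sim U(B(\sigma))$ and $\xi_t\sim P_\xi$ independent, let $\overline\nabla F_T(x)=\frac1T\sum_{t=1}^T\widetilde\nabla F(x+z_t,\xi_t)$, and let $\bar x^*\in\operatorname{argmin}_{x\in\overline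 X}\|\overline\nabla F_T(x)\|_2$ be chosen in any way. Then: 1. $\bar x^*$ is an $(\epsilon_1,\epsilon_2)$-stationary point with probability at least $1-\gamma$. 2. The method, including the computation of $\overline\nabla F_T(\bar x^i)$ for $i=1,\dots,\mathcal{R}$, requires $\tilde O\left(\frac{1}{\epsilon_1\epsilon_2^4}+\frac{1}{\gamma\epsilon_2^2}\right)$ gradient calls. That is, there are $k\in\mathbb{N}$ and $M\in\mathbb{R}$, depending only on $d,c,\phi,L_0,Q,\Delta$, such that for all $\epsilon_1,\epsilon_2\in(0,1]$ and $\gamma\in(0,1)$ the number of gradient calls, for every outcome of the sampling, is at most $M\,g\,(\log g)^k$ with $g=\frac{1}{\epsilon_1\epsilon_2^4}+\frac{1}{\gamma\epsilon_2^2}$. -/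

import Mathlib

noncomputable section

namespace PISGD

/-- `ℝⁿ` with the Euclidean norm. -/
abbrev Vec (n : ℕ) : Type := EuclideanSpace ℝ (Fin n)

/-! ### Clarke subdifferentials and stationarity -/

/-- Clarke subdifferential of a (locally Lipschitz) function: the convex hull of all limits of
gradients along sequences of differentiability points that converge to `w`. -/
def clarkeSubdiff {d : ℕ} (f : Vec d → ℝ) (w : Vec d) : Set (Vec d) :=
  convexHull ℝ {g | ∃ u : ℕ → Vec d, Filter.Tendsto u Filter.atTop (nhds w) ∧
    (∀ i, DifferentiableAt ℝ f (u i)) ∧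
    Filter.Tendsto (fun i => gradient f (u i)) Filter.atTop (nhds g)}

/-- Clarke `ε`-subdifferential: the convex hull of the Clarke subdifferentials at all points of the
closed Euclidean ball of radius `ε` about `w`. -/
def clarkeEpsSubdiff {d : ℕ} (f : Vec d → ℝ) (ε : ℝ) (w : Vec d) : Set (Vec d) :=
  convexHull ℝ (⋃ v ∈ Metric.closedBall w ε, clarkeSubdiff f v)

/-- `(ε₁, ε₂)`-stationarity: `dist(0, ∂_{ε₁} f(w)) ≤ ε₂`. The extended distance is used, so that the
distance to an empty set would be `∞`. -/
def IsStationary {d : ℕ} (f : Vec d → ℝ) (ε₁ ε₂ : ℝ) (w : Vec d) : Prop :=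
  Metric.infEDist 0 (clarkeEpsSubdiff f ε₁ w) ≤ ENNReal.ofReal ε₂

/-! ### The stochastic problem -/

/-- The data of a stochastic minimization problem `min_w f(w) = E_ξ[F(w, ξ)]` under the standing
assumptions, with an approximate stochastic gradient. -/
structure Problem (d p : ℕ) where
  /-- the law of the random vector `ξ` -/
  law : MeasureTheory.Measure (Vec p)
  isProb : MeasureTheory.IsProbabilityMeasure law
  /-- the stochastic function `F(w, ξ)` -/
  F : Vec d → Vec p → ℝ
  /-- `F` is a Carathéodory function -/
  measurable_F : ∀ w, Measurable (F w)
  continuous_F : ∀ ξ, Continuous fun w => F w ξ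
  /-- `E_ξ[F(w, ξ)]` exists -/
  integrable_F : ∀ w, MeasureTheory.Integrable (F w) law
  /-- the Lipschitz constant `C(ξ)` of `F(·, ξ)` -/
  C : Vec p → ℝ
  lipschitz_F : ∀ᵐ ξ ∂law, ∀ w w', |F w ξ - F w' ξ| ≤ C ξ * ‖w - w'‖
  /-- `E[C(ξ)²] < ∞` -/
  memLp_C : MeasureTheory.MemLp C 2 law
  /-- the approximate stochastic gradient -/
  G : Vec d → Vec p → Vec d
  measurable_G : Measurable fun q : Vec d × Vec p => G q.1 q.2
  /-- `G` equals the gradient of `F` in `w` almost everywhere it exists -/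
  G_eq_gradient : ∀ᵐ q ∂((MeasureTheory.volume : MeasureTheory.Measure (Vec d)).prod law),
    DifferentiableAt ℝ (fun w => F w q.2) q.1 → G q.1 q.2 = gradient (fun w => F w q.2) q.1

namespace Problem

variable {d p : ℕ} (P : Problem d p)

/-- The objective `f(w) = E_ξ[F(w, ξ)]`. -/
def f (w : Vec d) : ℝ := ∫ ξ, P.F w ξ ∂P.law

/-- `L₀ = E[C(ξ)]`. -/
def L₀ : ℝ := ∫ ξ, P.C ξ ∂P.law

/-- `Q = E[C(ξ)²]`. -/
def Q : ℝ := ∫ ξ, P.C ξ ^ 2 ∂P.law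

end Problem

/-! ### The algorithm, with a counter for gradient calls -/

/-- One gradient call, returning the value and its cost. -/
def gradCall {d p : ℕ} (G : Vec d → Vec p → Vec d) (w : Vec d) (ξ : Vec p) : Vec d × ℕ :=
  (G w ξ, 1)

/-- The mini-batch average `(1/n) ∑ₗ G(x + zₗ, ξₗ)`, with the number of gradient calls made. -/
def avgGrad {d p : ℕ} (G : Vec d → Vec p → Vec d) {n : ℕ} (s : Fin n → Vec d × Vec p)
    (x : Vec d) : Vec d × ℕ :=
  ((n : ℝ)⁻¹ • ∑ l, (gradCall G (x + (s l).1) (s l).2).1,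
    ∑ l, (gradCall G (x + (s l).1) (s l).2).2)

/-- `n` iterations `x ← x - η · avgGrad(x)` from `x₁`, the `k`-th one using the batch `s k` of `S`
samples `(z, ξ)`. Returns the last iterate and the number of gradient calls made. -/
def iterate {d p : ℕ} (G : Vec d → Vec p → Vec d) (η : ℝ) {S : ℕ} (x₁ : Vec d) :
    (n : ℕ) → (Fin n → Fin S → Vec d × Vec p) → Vec d × ℕ
  | 0, _ => (x₁, 0)
  | n + 1, s =>
    let prev := iterate G η x₁ n (fun k => s k.castSucc)
    let step := avgGrad G (s (Fin.last n)) prev.1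
    (prev.1 - η • step.1, prev.2 + step.2)

/-- The random draws of one run of PISGD: an element `r` of `{0, …, K-1}`, where `R = r + 1`, and the
samples `(z, ξ)` of up to `K - 1` iterations (of which the first `R - 1` batches are used). -/
abbrev RunDraws (d p K S : ℕ) : Type := Fin K × (Fin (K - 1) → Fin S → Vec d × Vec p)

/-- One run of PISGD: its output `x^R`, and the number of gradient calls made. -/
def run {d p : ℕ} (G : Vec d → Vec p → Vec d) (η : ℝ) (x₁ : Vec d) {K S : ℕ}
    (D : RunDraws d p K S) : Vec d × ℕ :=
  iterate G η x₁ (D.1 : ℕ) (fun k => D.2 (k.castLE (Nat.le_sub_one_of_lt D.1.isLt)))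

/-- Settings of the two-phase method: `runs` runs of PISGD with parameters `K`, `S`, `η`, `σ`, and
`T` samples for choosing among the candidates. -/
structure Settings where
  runs : ℕ
  T : ℕ
  K : ℕ
  S : ℕ
  η : ℝ
  σ : ℝ

/-- All random draws of the method: those of each run, and the `T` selection samples. -/
abbrev Draws (d p : ℕ) (m : Settings) : Type :=
  (Fin m.runs → RunDraws d p m.K m.S) × (Fin m.T → Vec d × Vec p)

/-- The uniform distribution on the closed Euclidean ball of radius `σ` about `0`. -/
def uniformBall (d : ℕ) (σ : ℝ) : MeasureTheory.Measure (Vec d) :=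
  ProbabilityTheory.cond MeasureTheory.volume (Metric.closedBall 0 σ)

/-- The law of one pair `(z, ξ)`: independent, `z` uniform on the ball and `ξ` with its law. -/
def sampleLaw {d p : ℕ} (P : Problem d p) (σ : ℝ) : MeasureTheory.Measure (Vec d × Vec p) :=
  (uniformBall d σ).prod P.law

/-- The joint law of all draws: everything is sampled independently. -/
def drawsLaw {d p : ℕ} (P : Problem d p) (m : Settings) : MeasureTheory.Measure (Draws d p m) :=
  (MeasureTheory.Measure.pi fun _ : Fin m.runs =>
    (ProbabilityTheory.uniformOn (Set.univ : Set (Fin m.K))).prod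
      (MeasureTheory.Measure.pi fun _ : Fin (m.K - 1) =>
        MeasureTheory.Measure.pi fun _ : Fin m.S => sampleLaw P m.σ)).prod
  (MeasureTheory.Measure.pi fun _ : Fin m.T => sampleLaw P m.σ)

/-- The candidate solutions: the outputs of the runs. -/
def candidates {d p : ℕ} (G : Vec d → Vec p → Vec d) (x₁ : Vec d) {m : Settings}
    (D : Draws d p m) : Set (Vec d) :=
  Set.range fun i => (run G m.η x₁ (D.1 i)).1

/-- The candidates with the smallest norm of the averaged stochastic gradient over the `T` selection
samples (the same samples for all candidates). -/
def selected {d p : ℕ} (G : Vec d → Vec p → Vec d) (x₁ : Vec d) {m : Settings}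
    (D : Draws d p m) : Set (Vec d) :=
  {x | x ∈ candidates G x₁ D ∧
    ∀ y ∈ candidates G x₁ D, ‖(avgGrad G D.2 x).1‖ ≤ ‖(avgGrad G D.2 y).1‖}

/-- The number of gradient calls of the whole method: those of all runs, and those for evaluating the
averaged stochastic gradient at the output of every run. -/
def totalCalls {d p : ℕ} (G : Vec d → Vec p → Vec d) (x₁ : Vec d) {m : Settings}
    (D : Draws d p m) : ℕ :=
  ∑ i, (run G m.η x₁ (D.1 i)).2 + ∑ i, (avgGrad G D.2 (run G m.η x₁ (D.1 i)).1).2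

/-! ### The choice of the settings -/

/-- Number of runs `⌈-ln(cγ)⌉`. -/
def numRuns (c γ : ℝ) : ℕ := ⌈-Real.log (c * γ)⌉₊

/-- `ψ = (⌈-ln(cγ)⌉ + 1) / ((1 - c)γ)`. -/
def psi (c γ : ℝ) : ℝ := ((numRuns c γ : ℝ) + 1) / ((1 - c) * γ)

/-- `T = ⌈6φψQ/ε₂²⌉`. -/
def numSel (c φ γ Q ε₂ : ℝ) : ℕ := ⌈6 * φ * psi c γ * (Q / ε₂ ^ 2)⌉₊

/-- `ε₂' = √((ε₂² - 6ψQ/T) / (4e))`. -/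
def eps₂' (c φ γ Q ε₂ : ℝ) : ℝ :=
  √((ε₂ ^ 2 - 6 * psi c γ * (Q / (numSel c φ γ Q ε₂ : ℝ))) / (4 * Real.exp 1))

/-- The number `K`, for a target accuracy `(ε₁, e₂)`. -/
def bigK (d : ℕ) (L₀ Q Δ ε₁ e₂ : ℝ) : ℕ :=
  max ⌊2 / e₂ ^ 2 * (L₀ * Δ + Q + √d * L₀ ^ 2) + 1⌋₊
    ⌈2 * √d / e₂ ^ 2 * ((L₀ * Δ + Q) / ε₁ + L₀ ^ 2)⌉₊

/-- The exponent `β`, for a target accuracy `(ε₁, e₂)`. If `K = 1`, then `log K = 0` and this is `0`,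
but then none of `S`, `σ`, `η` below depends on `β`. -/
def beta (d : ℕ) (L₀ Q Δ ε₁ e₂ : ℝ) : ℝ :=
  (Real.log ((bigK d L₀ Q Δ ε₁ e₂ : ℝ) * e₂ ^ 2 - 2 * √d * L₀ ^ 2)
    - Real.log (2 * (L₀ * Δ + Q))) / Real.log (bigK d L₀ Q Δ ε₁ e₂ : ℝ)

/-- PISGD parameters from `K` and `β` (with `θ = 1`): `S = ⌈K^(1-β)⌉`, `η = K^(-β)/L₀`,
`σ = √d K^(-β)`. -/
def settingsOf (d : ℕ) (L₀ : ℝ) (runs T K : ℕ) (β : ℝ) : Settings where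
  runs := runs
  T := T
  K := K
  S := ⌈(K : ℝ) ^ (1 - β)⌉₊
  η := 1 / L₀ * (K : ℝ) ^ (-β)
  σ := √d * (K : ℝ) ^ (-β)

/-- The settings of the method. -/
def settings (d : ℕ) (c φ L₀ Q Δ γ ε₁ ε₂ : ℝ) : Settings :=
  settingsOf d L₀ (numRuns c γ) (numSel c φ γ Q ε₂)
    (bigK d L₀ Q Δ ε₁ (eps₂' c φ γ Q ε₂)) (beta d L₀ Q Δ ε₁ (eps₂' c φ γ Q ε₂))

/-- The rate `1/(ε₁ε₂⁴) + 1/(γε₂²)`. -/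
def rate (γ ε₁ ε₂ : ℝ) : ℝ := 1 / (ε₁ * ε₂ ^ 4) + 1 / (γ * ε₂ ^ 2)

end PISGD

end

namespace PISGD

open MeasureTheory Metric Filter Topology Set ProbabilityTheory
open scoped ENNReal NNReal RealInnerProductSpace

section

variable {d : ℕ}

/-! ### Averages over shells and a radial cutoff -/

/-! Let f_σ(x) = E f(x + z) with z uniform on the ball of radius σ. PISGD is minibatch SGD on f_σ,
and the proof has four ingredients.

Smoothing. ∇f_σ(x) is the average of ∇f over the ball about x, hence lies in the closure of ∂_σ f(x)
(`smoothGrad_mem_closure`). So σ ≤ ε₁ and ‖∇f_σ(x)‖ ≤ ε₂ give stationarity. Moreover ∇f_σ is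
Lipschitz with constant √d L₀/σ (`norm_smoothGrad_sub_le`). Integration by parts moves the
derivative onto a radial cutoff of the ball, and on a shell the mean of |⟪z, v⟫|/‖z‖ is at most
‖v‖/√d.

Estimation. By Rademacher and Fubini, G(x + z, ξ) is almost surely the gradient of F(·, ξ), bounded
by C(ξ). It is unbiased for ∇f_σ(x) (`integral_G_add`), and an average of n samples has mean squared
error at most Q/n.

Descent. The step η is the inverse of the Lipschitz constant of ∇f_σ. One step then lowers f_σ by
η/2 ‖∇f_σ‖², up to η/2 times the squared error of the batch. Telescoping and the uniform choice of
the output index give E‖∇f_σ(x^R)‖² ≤ 2(Δ + L₀σ)/(Kη) + Q/S (`lintegral_run_le`). With the given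
parameters this is at most ε₂'².

Selection. By Markov, a run exceeds exp(1) ε₂'² with probability at most 1/exp(1), so all runs do
with probability at most cγ. A selection estimate has squared error above ψQ/T with probability at
most 1/ψ, and a union bound over the candidates costs (1 - c)γ. Otherwise the selected point
satisfies ‖∇f_σ‖² ≤ 4 exp(1) ε₂'² + 6ψQ/T = ε₂².

For the cost, T is large enough that ε₂'² is at least a constant times ε₂². Hence K = O(1/(ε₁ε₂²))
and S = O(1/ε₂²), while the number of runs is logarithmic. -/

/-- The reflection in the hyperplane orthogonal to `v - w` maps `v` to `w` and preserves both volume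
and norms. -/
theorem integral_inner_sq_congr {h : ℝ → ℝ} {v w : Vec d} (hvw : ‖v‖ = ‖w‖) :
    ∫ z : Vec d, h ‖z‖ * ⟪z, v⟫ ^ 2 = ∫ z : Vec d, h ‖z‖ * ⟪z, w⟫ ^ 2 := by
  set R := (ℝ ∙ (v - w))ᗮ.reflection with hR
  have hv : R v = w := Submodule.reflection_sub hvw
  rw [← (R.measurePreserving).integral_comp R.toHomeomorph.measurableEmbedding
    (fun z => h ‖z‖ * ⟪z, w⟫ ^ 2)]
  refine integral_congr_ae (Eventually.of_forall fun z => ?_)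
  simp only [LinearIsometryEquiv.norm_map]
  rw [← hv, LinearIsometryEquiv.inner_map_map]

/-- By rotational symmetry every coordinate direction contributes the same second moment, and over
an orthonormal basis these moments sum to that of `‖z‖`. -/
theorem integral_inner_sq {h : ℝ → ℝ} (v : Vec d)
    (hi : ∀ w : Vec d, Integrable fun z : Vec d => h ‖z‖ * ⟪z, w⟫ ^ 2) :
    (d : ℝ) * ∫ z : Vec d, h ‖z‖ * ⟪z, v⟫ ^ 2 = ‖v‖ ^ 2 * ∫ z : Vec d, h ‖z‖ * ‖z‖ ^ 2 := by
  have key : ∀ i : Fin d, ∫ z : Vec d, h ‖z‖ * ⟪z, v⟫ ^ 2 =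
      ‖v‖ ^ 2 * ∫ z : Vec d, h ‖z‖ * ⟪z, EuclideanSpace.single i (1 : ℝ)⟫ ^ 2 := by
    intro i
    rw [integral_inner_sq_congr (w := ‖v‖ • EuclideanSpace.single i (1 : ℝ)) (by
      simp [norm_smul]), ← integral_const_mul]
    refine integral_congr_ae (Eventually.of_forall fun z => ?_)
    simp only [inner_smul_right]
    ring
  calc (d : ℝ) * ∫ z : Vec d, h ‖z‖ * ⟪z, v⟫ ^ 2
      = ∑ i : Fin d, ‖v‖ ^ 2 * ∫ z : Vec d, h ‖z‖ * ⟪z, EuclideanSpace.single i (1 : ℝ)⟫ ^ 2 := by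
        rw [← Finset.sum_congr rfl fun i _ => key i]; simp
    _ = ‖v‖ ^ 2 * ∫ z : Vec d, h ‖z‖ * ‖z‖ ^ 2 := by
        rw [← Finset.mul_sum, ← integral_finsetSum _ fun i _ => hi _]
        congr 1
        refine integral_congr_ae (Eventually.of_forall fun z => ?_)
        simp only
        rw [← Finset.mul_sum, EuclideanSpace.norm_sq_eq]
        simp [EuclideanSpace.inner_single_right]

/-- The closed shell with radii `r` and `σ` about the origin. -/
def shell (d : ℕ) (r σ : ℝ) : Set (Vec d) := {z | r ≤ ‖z‖ ∧ ‖z‖ ≤ σ}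

theorem measurableSet_shell (r σ : ℝ) : MeasurableSet (shell d r σ) :=
  (measurableSet_le measurable_const measurable_norm).inter
    (measurableSet_le measurable_norm measurable_const)

theorem shell_subset (r σ : ℝ) : shell d r σ ⊆ closedBall 0 σ := fun z hz => by
  simpa using hz.2

theorem volume_shell_lt_top (r σ : ℝ) : volume (shell d r σ) < ∞ :=
  (measure_mono (shell_subset r σ)).trans_lt measure_closedBall_lt_top

/-- Factor σ^d - r^d by the geometric sum. The factor σ - r will cancel the slope of the cutoff. -/
theorem volume_real_shell_le (hd : 0 < d) {r σ : ℝ} (hr : 0 < r) (hrσ : r < σ) :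
    volume.real (shell d r σ) ≤
      (σ - r) * (d * σ ^ (d - 1)) * volume.real (ball (0 : Vec d) 1) := by
  have : Nonempty (Fin d) := ⟨⟨0, hd⟩⟩
  have h1 : shell d r σ = closedBall 0 σ \ ball 0 r := by
    ext z; simp [shell, and_comm]
  have hsub : ball (0 : Vec d) r ⊆ closedBall 0 σ :=
    ball_subset_closedBall.trans (closedBall_subset_closedBall hrσ.le)
  have hball : volume.real (ball (0 : Vec d) r) = r ^ d * volume.real (ball (0 : Vec d) 1) := by
    rw [measureReal_def, Measure.addHaar_ball _ _ hr.le, ENNReal.toReal_mul,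
      ENNReal.toReal_ofReal (by positivity), finrank_euclideanSpace, Fintype.card_fin,
      measureReal_def]
  rw [h1, measureReal_sdiff hsub measurableSet_ball (by exact measure_closedBall_lt_top.ne),
    Measure.addHaar_real_closedBall _ _ (hr.trans hrσ).le, hball]
  simp only [finrank_euclideanSpace, Fintype.card_fin]
  rw [← sub_mul]
  refine mul_le_mul_of_nonneg_right ?_ measureReal_nonneg
  have : σ ^ d - r ^ d = (σ - r) * ∑ i ∈ Finset.range d, σ ^ i * r ^ (d - 1 - i) := by
    rw [mul_comm, (Commute.all σ r).geom_sum₂_mul]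
  rw [this]
  have hσ : 0 < σ := hr.trans hrσ
  refine mul_le_mul_of_nonneg_left ?_ (by linarith)
  calc ∑ i ∈ Finset.range d, σ ^ i * r ^ (d - 1 - i)
      ≤ ∑ i ∈ Finset.range d, σ ^ (d - 1) := by
        refine Finset.sum_le_sum fun i hi => ?_
        have hi' : i ≤ d - 1 := by have := Finset.mem_range.1 hi; omega
        calc σ ^ i * r ^ (d - 1 - i) ≤ σ ^ i * σ ^ (d - 1 - i) := by
              gcongr
          _ = σ ^ (d - 1) := by rw [← pow_add]; congr 1; omega
    _ = d * σ ^ (d - 1) := by simp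

/-- Cauchy–Schwarz together with isotropy: the mean square of ⟪z, v⟫/‖z‖ over the shell is exactly
‖v‖²/d. This gain of √d over the trivial bound turns the dimension factor d of the surface area into
√d. -/
theorem setIntegral_shell_inner_le (hd : 0 < d) {r σ : ℝ} (hr : 0 < r) (v : Vec d) :
    IntegrableOn (fun z : Vec d => |⟪z, v⟫| / ‖z‖) (shell d r σ) ∧
    ∫ z in shell d r σ, |⟪z, v⟫| / ‖z‖ ≤ ‖v‖ * volume.real (shell d r σ) / √d := by
  have hd0 : (0 : ℝ) < √d := by positivity
  have hm : ∀ w : Vec d, Measurable fun z : Vec d => |⟪z, w⟫| / ‖z‖ := fun w => by fun_prop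
  have hb : ∀ w z : Vec d, |⟪z, w⟫| / ‖z‖ ≤ ‖w‖ := fun w z =>
    div_le_of_le_mul₀ (norm_nonneg _) (norm_nonneg _)
      ((abs_real_inner_le_norm z w).trans_eq (mul_comm _ _))
  have h0 : ∀ w z : Vec d, 0 ≤ |⟪z, w⟫| / ‖z‖ := fun w z => by positivity
  have : IsFiniteMeasure (volume.restrict (shell d r σ)) :=
    ⟨by simpa using volume_shell_lt_top r σ⟩
  have hint : ∀ w : Vec d, IntegrableOn (fun z : Vec d => |⟪z, w⟫| / ‖z‖) (shell d r σ) := fun w =>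
    Integrable.of_bound (hm w).aestronglyMeasurable ‖w‖ (Eventually.of_forall fun z => by
      rw [Real.norm_of_nonneg (h0 w z)]; exact hb w z)
  have hint2 : ∀ w : Vec d, IntegrableOn (fun z : Vec d => (|⟪z, w⟫| / ‖z‖) ^ 2) (shell d r σ) :=
    fun w => Integrable.of_bound ((hm w).pow_const 2).aestronglyMeasurable (‖w‖ ^ 2)
      (Eventually.of_forall fun z => by
      rw [Real.norm_of_nonneg (by positivity)]; gcongr; exact hb w z)
  refine ⟨hint v, ?_⟩
  set h : ℝ → ℝ := (Set.Icc r σ).indicator fun t => (t ^ 2)⁻¹ with hh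
  have hind : ∀ w : Vec d, (fun z : Vec d => h ‖z‖ * ⟪z, w⟫ ^ 2) =
      (shell d r σ).indicator fun z => (|⟪z, w⟫| / ‖z‖) ^ 2 := by
    intro w; funext z
    by_cases hz : z ∈ shell d r σ
    · rw [Set.indicator_of_mem hz, hh, Set.indicator_of_mem (show ‖z‖ ∈ Set.Icc r σ from hz),
        div_pow, sq_abs]; ring
    · rw [Set.indicator_of_notMem hz, hh, Set.indicator_of_notMem (show ‖z‖ ∉ Set.Icc r σ from hz),
        zero_mul]
  have hsq : ∫ z in shell d r σ, (|⟪z, v⟫| / ‖z‖) ^ 2 =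
      ‖v‖ ^ 2 * volume.real (shell d r σ) / d := by
    have := integral_inner_sq (h := h) v fun w => by
      rw [hind w, integrable_indicator_iff (measurableSet_shell r σ)]; exact hint2 w
    rw [hind v, integral_indicator (measurableSet_shell r σ)] at this
    have h2 : (fun z : Vec d => h ‖z‖ * ‖z‖ ^ 2) = (shell d r σ).indicator fun _ => (1 : ℝ) := by
      funext z
      by_cases hz : z ∈ shell d r σ
      · have : ‖z‖ ≠ 0 := (hr.trans_le hz.1).ne'
        rw [Set.indicator_of_mem hz, hh, Set.indicator_of_mem (show ‖z‖ ∈ Set.Icc r σ from hz)]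
        field_simp
      · rw [Set.indicator_of_notMem hz, hh,
          Set.indicator_of_notMem (show ‖z‖ ∉ Set.Icc r σ from hz), zero_mul]
    rw [h2, integral_indicator (measurableSet_shell r σ)] at this
    simp only [integral_const, MeasurableSet.univ, measureReal_restrict_apply, univ_inter,
      smul_eq_mul, mul_one] at this
    rw [eq_div_iff (by positivity), mul_comm, this]
  by_cases hv : v = 0
  · simp [hv]
  have hv0 : 0 < ‖v‖ := norm_pos_iff.2 hv
  have hds : √(d : ℝ) ^ 2 = d := Real.sq_sqrt (by positivity)
  calc ∫ z in shell d r σ, |⟪z, v⟫| / ‖z‖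
      -- Cauchy–Schwarz in the form of Young's inequality, with the weight for which the two terms
      -- have equal integrals.
      ≤ ∫ z in shell d r σ, ((√d / (2 * ‖v‖)) * (|⟪z, v⟫| / ‖z‖) ^ 2 + ‖v‖ / (2 * √d)) := by
        refine integral_mono (hint v) (((hint2 v).const_mul _).add (integrable_const _)) fun z => ?_
        simp only
        set u := |⟪z, v⟫| / ‖z‖
        have : √d / (2 * ‖v‖) * u ^ 2 + ‖v‖ / (2 * √d) - u =
            (√d * u - ‖v‖) ^ 2 / (2 * ‖v‖ * √d) := by field_simp; ring
        have h3 : 0 ≤ (√d * u - ‖v‖) ^ 2 / (2 * ‖v‖ * √d) := by positivity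
        linarith
    _ = ‖v‖ * volume.real (shell d r σ) / √d := by
        rw [integral_add ((hint2 v).const_mul _) (integrable_const _), integral_const_mul, hsq]
        simp only [integral_const, MeasurableSet.univ, measureReal_restrict_apply, univ_inter,
          smul_eq_mul]
        have : (d : ℝ) ≠ 0 := by positivity
        field_simp
        rw [hds]
        ring


/-- The piecewise linear radial cutoff between the balls of radii `r` and `σ`. -/
noncomputable def cutoff (d : ℕ) (r σ : ℝ) (z : Vec d) : ℝ := max 0 (min 1 ((σ - ‖z‖) / (σ - r)))

theorem cutoff_nonneg (r σ : ℝ) (z : Vec d) : 0 ≤ cutoff d r σ z := le_max_left _ _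

theorem cutoff_le_one (r σ : ℝ) (z : Vec d) : cutoff d r σ z ≤ 1 :=
  max_le zero_le_one (min_le_left _ _)

theorem cutoff_eq_one {r σ : ℝ} (hrσ : r < σ) {z : Vec d} (hz : ‖z‖ ≤ r) : cutoff d r σ z = 1 := by
  have : 1 ≤ (σ - ‖z‖) / (σ - r) := by rw [le_div_iff₀ (by linarith)]; linarith
  rw [cutoff, min_eq_left this]; simp

theorem cutoff_eq_zero {r σ : ℝ} (hrσ : r < σ) {z : Vec d} (hz : σ ≤ ‖z‖) : cutoff d r σ z = 0 := by
  have : (σ - ‖z‖) / (σ - r) ≤ 0 := div_nonpos_of_nonpos_of_nonneg (by linarith) (by linarith)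
  rw [cutoff]
  exact max_eq_left ((min_le_right _ _).trans this)

theorem cutoff_eq {r σ : ℝ} (hrσ : r < σ) {z : Vec d} (hz : r ≤ ‖z‖) (hz' : ‖z‖ ≤ σ) :
    cutoff d r σ z = (σ - ‖z‖) / (σ - r) := by
  have h1 : (σ - ‖z‖) / (σ - r) ≤ 1 := by rw [div_le_one (by linarith)]; linarith
  have h2 : 0 ≤ (σ - ‖z‖) / (σ - r) := div_nonneg (by linarith) (by linarith)
  rw [cutoff, min_eq_right h1, max_eq_right h2]

theorem lipschitzWith_cutoff {r σ : ℝ} (hrσ : r < σ) :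
    LipschitzWith (Real.toNNReal (σ - r)⁻¹) (cutoff d r σ) := by
  refine LipschitzWith.const_max (LipschitzWith.const_min ?_ _) _
  have hpos : 0 < σ - r := by linarith
  refine LipschitzWith.of_dist_le_mul fun x y => ?_
  rw [Real.coe_toNNReal _ (by positivity), Real.dist_eq, ← sub_div, abs_div, abs_of_pos hpos,
    div_eq_inv_mul, dist_eq_norm]
  gcongr
  rw [show σ - ‖x‖ - (σ - ‖y‖) = -(‖x‖ - ‖y‖) by ring, abs_neg]
  exact abs_norm_sub_norm_le x y

theorem hasCompactSupport_cutoff {r σ : ℝ} (hrσ : r < σ) : HasCompactSupport (cutoff d r σ) := by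
  refine HasCompactSupport.intro (isCompact_closedBall (0 : Vec d) σ) fun z hz => ?_
  exact cutoff_eq_zero hrσ (by simpa using (not_le.1 (by simpa using hz)).le)

theorem hasLineDerivAt_norm {z : Vec d} (hz : z ≠ 0) (v : Vec d) :
    HasLineDerivAt ℝ (fun x : Vec d => ‖x‖) (⟪z, v⟫ / ‖z‖) z v := by
  have h1 : HasDerivAt (fun t : ℝ => z + t • v) v 0 := by
    simpa using ((hasDerivAt_id (0 : ℝ)).smul_const v).const_add z
  have h2 := h1.norm_sq.sqrt (by simpa using hz)
  have h3 : (fun t : ℝ => √(‖z + t • v‖ ^ 2)) = fun t : ℝ => ‖z + t • v‖ := by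
    funext t; exact Real.sqrt_sq (norm_nonneg _)
  have h4 : 2 * ⟪z + (0 : ℝ) • v, v⟫ / (2 * √(‖z + (0 : ℝ) • v‖ ^ 2)) = ⟪z, v⟫ / ‖z‖ := by
    simp only [zero_smul, add_zero, Real.sqrt_sq (norm_nonneg z)]
    field_simp
  rw [h3, h4] at h2
  exact h2

/-- Off the two bounding spheres, which are null sets, the cutoff is locally constant or affine in
`‖z‖`. -/
theorem abs_lineDeriv_cutoff_le {r σ : ℝ} (hr : 0 < r) (hrσ : r < σ) (v : Vec d) :
    ∀ᵐ z : Vec d, |lineDeriv ℝ (cutoff d r σ) z v| ≤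
      (shell d r σ).indicator (fun z => (σ - r)⁻¹ * (|⟪z, v⟫| / ‖z‖)) z := by
  have hpos : 0 < σ - r := by linarith
  have hs : ∀ s : ℝ, 0 < s → ∀ᵐ z : Vec d, ‖z‖ ≠ s := fun s hs => by
    have := Measure.addHaar_sphere_of_ne_zero (volume : Measure (Vec d)) 0 hs.ne'
    filter_upwards [compl_mem_ae_iff.2 this] with z hz
    simpa using hz
  filter_upwards [hs r hr, hs σ (hr.trans hrσ)] with z hz1 hz2
  have hnn : 0 ≤ (shell d r σ).indicator (fun z => (σ - r)⁻¹ * (|⟪z, v⟫| / ‖z‖)) z :=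
    Set.indicator_nonneg (fun z _ => by positivity) z
  have hconst : ∀ c : ℝ, lineDeriv ℝ (fun _ : Vec d => c) z v = 0 := fun c => by
    rw [(differentiableAt_const c).lineDeriv_eq_fderiv]; simp
  rcases lt_or_gt_of_ne hz1 with h1 | h1
  · have : cutoff d r σ =ᶠ[𝓝 z] fun _ => (1 : ℝ) := by
      filter_upwards [(isOpen_lt continuous_norm continuous_const).mem_nhds h1] with y hy
      exact cutoff_eq_one hrσ (le_of_lt hy)
    rw [this.lineDeriv_eq, hconst, abs_zero]; exact hnn
  rcases lt_or_gt_of_ne hz2 with h2 | h2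
  · have : cutoff d r σ =ᶠ[𝓝 z] fun y => (σ - r)⁻¹ * (σ - ‖y‖) := by
      filter_upwards [(isOpen_lt continuous_norm continuous_const).mem_nhds h2,
        (isOpen_lt continuous_const continuous_norm).mem_nhds h1] with y hy hy'
      rw [cutoff_eq hrσ (le_of_lt hy') (le_of_lt hy)]; ring
    rw [this.lineDeriv_eq, Set.indicator_of_mem (show z ∈ shell d r σ from ⟨h1.le, h2.le⟩)]
    have hz0 : z ≠ 0 := norm_pos_iff.1 (hr.trans h1)
    have hd : HasLineDerivAt ℝ (fun y : Vec d => (σ - r)⁻¹ * (σ - ‖y‖))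
        ((σ - r)⁻¹ * (-(⟪z, v⟫ / ‖z‖))) z v := by
      have := hasLineDerivAt_norm hz0 v
      unfold HasLineDerivAt at this ⊢
      exact (this.const_sub σ).const_mul _
    rw [hd.lineDeriv, abs_mul, abs_neg, abs_div, abs_norm, abs_of_pos (inv_pos.2 hpos)]
  · have : cutoff d r σ =ᶠ[𝓝 z] fun _ => (0 : ℝ) := by
      filter_upwards [(isOpen_lt continuous_const continuous_norm).mem_nhds h2] with y hy
      exact cutoff_eq_zero hrσ (le_of_lt hy)
    rw [this.lineDeriv_eq, hconst, abs_zero]; exact hnn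

/-- Integration by parts moves the derivative onto the cutoff, so that the sup bound `B` of `h`
enters and not its Lipschitz constant. The slope 1/(σ - r) cancels against the volume of the shell,
which leaves a bound independent of `r`. -/
theorem abs_integral_lineDeriv_mul_cutoff_le (hd : 0 < d) {h : Vec d → ℝ} {C : ℝ≥0} {B r σ : ℝ}
    (hh : LipschitzWith C h) (hB : ∀ z, |h z| ≤ B) (hr : 0 < r) (hrσ : r < σ) (v : Vec d) :
    |∫ z, lineDeriv ℝ h z v * cutoff d r σ z| ≤
      B * ‖v‖ * (√d * σ ^ (d - 1)) * volume.real (ball (0 : Vec d) 1) := by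
  have hB0 : 0 ≤ B := (abs_nonneg _).trans (hB 0)
  have hpos : 0 < σ - r := by linarith
  have hσ : 0 < σ := hr.trans hrσ
  rw [LipschitzWith.integral_lineDeriv_mul_eq hh (lipschitzWith_cutoff hrσ)
    (hasCompactSupport_cutoff hrσ)]
  obtain ⟨hi, hle⟩ := setIntegral_shell_inner_le (σ := σ) hd hr (-v)
  have hi' : Integrable fun z => (shell d r σ).indicator
      (fun z => (σ - r)⁻¹ * (|⟪z, -v⟫| / ‖z‖)) z * B :=
    ((integrable_indicator_iff (measurableSet_shell r σ)).2 (hi.const_mul _)).mul_const B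
  calc |∫ z, lineDeriv ℝ (cutoff d r σ) z (-v) * h z|
      ≤ ∫ z, (shell d r σ).indicator (fun z => (σ - r)⁻¹ * (|⟪z, -v⟫| / ‖z‖)) z * B := by
        rw [← Real.norm_eq_abs]
        refine norm_integral_le_of_norm_le hi' ?_
        filter_upwards [abs_lineDeriv_cutoff_le hr hrσ (-v)] with z hz
        rw [norm_mul]
        exact mul_le_mul hz (hB z) (abs_nonneg _) ((abs_nonneg _).trans hz)
    _ = (σ - r)⁻¹ * (∫ z in shell d r σ, |⟪z, -v⟫| / ‖z‖) * B := by
        rw [integral_mul_const, integral_indicator (measurableSet_shell r σ), integral_const_mul]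
    _ ≤ (σ - r)⁻¹ * (‖-v‖ * ((σ - r) * (d * σ ^ (d - 1)) * volume.real (ball (0 : Vec d) 1))
          / √d) * B := by
        gcongr
        refine hle.trans ?_
        gcongr
        exact volume_real_shell_le hd hr hrσ
    _ = B * ‖v‖ * (√d * σ ^ (d - 1)) * volume.real (ball (0 : Vec d) 1) := by
        have h1 : (0 : ℝ) < √d := by positivity
        have h2 : (d : ℝ) = √d * √d := (Real.mul_self_sqrt (by positivity)).symm
        rw [norm_neg]
        field_simp
        rw [sq, ← h2]
        ring

theorem abs_setIntegral_lineDeriv_le (hd : 0 < d) {h : Vec d → ℝ} {C : ℝ≥0} {B σ : ℝ}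
    (hh : LipschitzWith C h) (hB : ∀ z, |h z| ≤ B) (hσ : 0 < σ) (v : Vec d) :
    |∫ z in ball 0 σ, lineDeriv ℝ h z v| ≤
      B * ‖v‖ * (√d * σ ^ (d - 1)) * volume.real (ball (0 : Vec d) 1) := by
  -- Inner radii tending to σ, at which the cutoff becomes the indicator of the open ball. The shift
  -- by 2 keeps the radius positive at `n = 0`.
  set r : ℕ → ℝ := fun n => σ * (1 - 1 / ((n : ℝ) + 2)) with hr
  have hfrac : ∀ n : ℕ, 1 / ((n : ℝ) + 2) < 1 := fun n => by
    rw [div_lt_one (by positivity)]; linarith [(Nat.cast_nonneg n : (0 : ℝ) ≤ n)]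
  have hr0 : ∀ n, 0 < r n := fun n => mul_pos hσ (by linarith [hfrac n])
  have hrσ : ∀ n, r n < σ := fun n => by
    have : 0 < 1 / ((n : ℝ) + 2) := by positivity
    simp only [hr]; nlinarith
  have hlim : Tendsto r atTop (𝓝 σ) := by
    have h1 : Tendsto (fun n : ℕ => 1 / ((n : ℝ) + 2)) atTop (𝓝 0) := by
      refine ((tendsto_add_atTop_iff_nat 1).2 (tendsto_one_div_add_atTop_nhds_zero_nat
        (𝕜 := ℝ))).congr fun n => ?_
      push_cast; ring
    simpa [hr] using (h1.const_sub 1).const_mul σ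
  have hm : ∀ z, |lineDeriv ℝ h z v| ≤ C * ‖v‖ := fun z =>
    norm_lineDeriv_le_of_lipschitz ℝ hh
  have hmeas : Measurable fun z => lineDeriv ℝ h z v := measurable_lineDeriv hh.continuous
  have key : Tendsto (fun n => ∫ z, lineDeriv ℝ h z v * cutoff d (r n) σ z) atTop
      (𝓝 (∫ z, (ball 0 σ).indicator (fun z => lineDeriv ℝ h z v) z)) := by
    refine tendsto_integral_of_dominated_convergence
      ((closedBall (0 : Vec d) σ).indicator fun _ => C * ‖v‖) (fun n => ?_) ?_ (fun n => ?_) ?_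
    · exact (hmeas.mul (lipschitzWith_cutoff (hrσ n)).continuous.measurable).aestronglyMeasurable
    · exact (integrable_indicator_iff measurableSet_closedBall).2
        (integrableOn_const measure_closedBall_lt_top.ne)
    · refine Eventually.of_forall fun z => ?_
      by_cases hz : z ∈ closedBall (0 : Vec d) σ
      · rw [Set.indicator_of_mem hz, norm_mul, Real.norm_of_nonneg (cutoff_nonneg _ _ _)]
        exact (mul_le_of_le_one_right (norm_nonneg _) (cutoff_le_one _ _ _)).trans (hm z)
      · rw [cutoff_eq_zero (hrσ n) (by simpa using (not_le.1 (by simpa using hz)).le),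
          Set.indicator_of_notMem hz]
        simp
    · refine Eventually.of_forall fun z => ?_
      by_cases hz : z ∈ ball (0 : Vec d) σ
      · rw [Set.indicator_of_mem hz]
        refine tendsto_const_nhds.congr' ?_
        filter_upwards [hlim.eventually (lt_mem_nhds (show ‖z‖ < σ by simpa using hz))] with n hn
        rw [cutoff_eq_one (hrσ n) hn.le, mul_one]
      · rw [Set.indicator_of_notMem hz]
        refine tendsto_const_nhds.congr fun n => ?_
        rw [cutoff_eq_zero (hrσ n) (by simpa using hz), mul_zero]
  rw [integral_indicator measurableSet_ball] at key
  exact le_of_tendsto key.abs (Eventually.of_forall fun n =>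
    abs_integral_lineDeriv_mul_cutoff_le hd hh hB (hr0 n) (hrσ n) v)

end

section

variable {d : ℕ}

/-! ### Gradients -/

/-- The integrands need to be differentiable only at the one point `x`, since the Lipschitz bound
dominates the difference quotients. This is what allows nonsmooth integrands, each with its own null
set of bad points. -/
theorem hasGradientAt_integral {α : Type*} [MeasurableSpace α] {μ : Measure α}
    {F : Vec d → α → ℝ} {g : α → Vec d} {C : α → ℝ} {x : Vec d}
    (hF : ∀ y, AEStronglyMeasurable (F y) μ) (hFi : Integrable (F x) μ)
    (hg : AEStronglyMeasurable g μ) (hC : Integrable C μ)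
    (hlip : ∀ᵐ a ∂μ, ∀ y, |F y a - F x a| ≤ C a * ‖y - x‖)
    (hd : ∀ᵐ a ∂μ, HasGradientAt (F · a) (g a) x) (hgi : Integrable g μ) :
    HasGradientAt (fun y => ∫ a, F y a ∂μ) (∫ a, g a ∂μ) x := by
  have := hasFDerivAt_integral_of_dominated_loc_of_lip' (μ := μ) (F := F) (x₀ := x) (s := univ)
    (F' := fun a => InnerProductSpace.toDual ℝ (Vec d) (g a)) (bound := C) univ_mem
    (fun y _ => hF y) hFi
    ((InnerProductSpace.toDual ℝ (Vec d)).continuous.comp_aestronglyMeasurable hg)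
    (by filter_upwards [hlip] with a ha y _ using ha y) hC
    (by filter_upwards [hd] with a ha using ha.hasFDerivAt)
  rw [hasGradientAt_iff_hasFDerivAt]
  have heq : InnerProductSpace.toDual ℝ (Vec d) (∫ a, g a ∂μ) =
      ∫ a, InnerProductSpace.toDual ℝ (Vec d) (g a) ∂μ := by
    ext v
    rw [ContinuousLinearMap.integral_apply this.1]
    simp only [InnerProductSpace.toDual_apply_apply]
    rw [real_inner_comm, ← integral_inner hgi]
    exact integral_congr_ae (Eventually.of_forall fun a => real_inner_comm _ _)
  rw [heq]
  exact this.2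

theorem norm_gradient_le {f : Vec d → ℝ} {L : ℝ≥0} (hf : LipschitzWith L f) (x : Vec d) :
    ‖gradient f x‖ ≤ L := by
  rw [gradient, LinearIsometryEquiv.norm_map]
  exact norm_fderiv_le_of_lipschitz ℝ hf

theorem measurable_gradient (f : Vec d → ℝ) : Measurable (gradient f) :=
  (InnerProductSpace.toDual ℝ (Vec d)).symm.continuous.measurable.comp (measurable_fderiv ℝ f)

/-- The descent lemma. -/
theorem le_add_inner_add_sq {φ : Vec d → ℝ} {g : Vec d → Vec d} {M : ℝ}
    (hφ : ∀ x, HasGradientAt φ (g x) x) (hg : ∀ x y, ‖g x - g y‖ ≤ M * ‖x - y‖) (x h : Vec d) :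
    φ (x + h) ≤ φ x + ⟪g x, h⟫ + M / 2 * ‖h‖ ^ 2 := by
  set ψ : ℝ → ℝ := fun t => φ (x + t • h) - t * ⟪g x, h⟫ - M / 2 * ‖h‖ ^ 2 * t ^ 2 with hψ
  have hder : ∀ t : ℝ, HasDerivAt ψ (⟪g (x + t • h), h⟫ - ⟪g x, h⟫ - M * ‖h‖ ^ 2 * t) t := by
    intro t
    have h1 : HasDerivAt (fun t : ℝ => x + t • h) h t := by
      simpa using ((hasDerivAt_id t).smul_const h).const_add x
    have h2 : HasDerivAt (fun t : ℝ => φ (x + t • h)) ⟪g (x + t • h), h⟫ t := by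
      have := (hφ (x + t • h)).hasFDerivAt.comp_hasDerivAt t h1
      rwa [InnerProductSpace.toDual_apply_apply] at this
    have h3 := (h2.sub ((hasDerivAt_id t).mul_const ⟪g x, h⟫)).sub
      (((hasDerivAt_id t).pow 2).const_mul (M / 2 * ‖h‖ ^ 2))
    refine h3.congr_deriv ?_
    simp
    ring
  have hanti : AntitoneOn ψ (Icc 0 1) := by
    refine antitoneOn_of_deriv_nonpos (convex_Icc 0 1)
      (fun t _ => (hder t).continuousAt.continuousWithinAt)
      (fun t _ => (hder t).differentiableAt.differentiableWithinAt) fun t ht => ?_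
    rw [interior_Icc] at ht
    rw [(hder t).deriv, ← inner_sub_left]
    have h1 : ⟪g (x + t • h) - g x, h⟫ ≤ ‖g (x + t • h) - g x‖ * ‖h‖ := real_inner_le_norm _ _
    have h2 := hg (x + t • h) x
    rw [add_sub_cancel_left, norm_smul, Real.norm_of_nonneg ht.1.le] at h2
    nlinarith [mul_le_mul_of_nonneg_right h2 (norm_nonneg h)]
  have := hanti (left_mem_Icc.2 zero_le_one) (right_mem_Icc.2 zero_le_one) zero_le_one
  simp only [hψ, one_smul, zero_smul, add_zero] at this
  linarith

/-! ### The uniform distribution on a ball -/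

theorem isProbabilityMeasure_uniformBall {σ : ℝ} (hσ : 0 < σ) :
    IsProbabilityMeasure (uniformBall d σ) :=
  ProbabilityTheory.cond_isProbabilityMeasure_of_finite (measure_closedBall_pos _ _ hσ).ne'
    measure_closedBall_lt_top.ne

theorem uniformBall_absolutelyContinuous (σ : ℝ) : uniformBall d σ ≪ volume :=
  ProbabilityTheory.cond_absolutelyContinuous

theorem ae_uniformBall_norm_le (σ : ℝ) : ∀ᵐ z ∂uniformBall d σ, ‖z‖ ≤ σ := by
  filter_upwards [ProbabilityTheory.ae_cond_mem (μ := (volume : Measure (Vec d)))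
    (measurableSet_closedBall (x := (0 : Vec d)) (ε := σ))] with z hz
  simpa using hz

theorem integral_uniformBall {σ : ℝ} (hσ : 0 < σ) (k : Vec d → ℝ) :
    ∫ z, k z ∂uniformBall d σ =
      (σ ^ d * volume.real (ball (0 : Vec d) 1))⁻¹ * ∫ z in ball 0 σ, k z := by
  rw [uniformBall, ProbabilityTheory.cond, integral_smul_measure, smul_eq_mul, ENNReal.toReal_inv,
    ← measureReal_def, Measure.addHaar_real_closedBall _ _ hσ.le, finrank_euclideanSpace,
    Fintype.card_fin]
  congr 1
  refine setIntegral_congr_set ?_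
  rw [← ball_union_sphere]
  refine union_ae_eq_left_of_ae_eq_empty (ae_eq_empty.2 ?_)
  exact Measure.addHaar_sphere_of_ne_zero _ _ hσ.ne'

/-! ### Smoothing by averaging over a ball -/

/-- The average of `f` over the ball of radius `σ` about `x`. -/
noncomputable def smooth (f : Vec d → ℝ) (σ : ℝ) (x : Vec d) : ℝ :=
  ∫ z, f (x + z) ∂uniformBall d σ

/-- The average of the gradient of `f` over the ball of radius `σ` about `x`. -/
noncomputable def smoothGrad (f : Vec d → ℝ) (σ : ℝ) (x : Vec d) : Vec d :=
  ∫ z, gradient f (x + z) ∂uniformBall d σ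

section

variable {f : Vec d → ℝ} {L : ℝ≥0} {σ : ℝ}

theorem ae_differentiableAt_add (hf : LipschitzWith L f) (x : Vec d) :
    ∀ᵐ z : Vec d, DifferentiableAt ℝ f (x + z) :=
  (measurePreserving_add_left volume x).quasiMeasurePreserving.ae hf.ae_differentiableAt

theorem integrable_gradient_add (hf : LipschitzWith L f) (hσ : 0 < σ) (x : Vec d) :
    Integrable (fun z => gradient f (x + z)) (uniformBall d σ) := by
  have := isProbabilityMeasure_uniformBall (d := d) hσ
  exact Integrable.of_bound ((measurable_gradient f).comp (measurable_const_add x)).aestronglyMeasurable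
    L (Eventually.of_forall fun z => norm_gradient_le hf _)

theorem integrable_comp_add (hf : LipschitzWith L f) (hσ : 0 < σ) (x : Vec d) :
    Integrable (fun z => f (x + z)) (uniformBall d σ) := by
  have := isProbabilityMeasure_uniformBall (d := d) hσ
  refine Integrable.of_bound
    (hf.continuous.comp (continuous_const_add x)).measurable.aestronglyMeasurable
    (|f x| + L * σ) ?_
  filter_upwards [ae_uniformBall_norm_le (d := d) σ] with z hz
  have h1 := hf.norm_sub_le (x + z) x
  rw [add_sub_cancel_left] at h1
  have h2 : (L : ℝ) * ‖z‖ ≤ L * σ := by gcongr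
  have h3 := norm_sub_norm_le (f (x + z)) (f x)
  rw [Real.norm_eq_abs (f x)] at h3
  linarith

theorem hasGradientAt_smooth (hf : LipschitzWith L f) (hσ : 0 < σ) (x : Vec d) :
    HasGradientAt (smooth f σ) (smoothGrad f σ x) x := by
  have := isProbabilityMeasure_uniformBall (d := d) hσ
  refine hasGradientAt_integral (C := fun _ => (L : ℝ))
    (fun y => (integrable_comp_add hf hσ y).aestronglyMeasurable) (integrable_comp_add hf hσ x)
    (integrable_gradient_add hf hσ x).aestronglyMeasurable (integrable_const _)
    (Eventually.of_forall fun z y => ?_) ?_ (integrable_gradient_add hf hσ x)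
  · simpa using hf.norm_sub_le (y + z) (x + z)
  · filter_upwards [(uniformBall_absolutelyContinuous σ).ae_le (ae_differentiableAt_add hf x)]
      with z hz
    rw [hasGradientAt_iff_hasFDerivAt]
    have h1 := hz.hasGradientAt.hasFDerivAt
    exact (hasFDerivAt_comp_add_right z).2 h1

theorem norm_smoothGrad_le (hf : LipschitzWith L f) (hσ : 0 < σ) (x : Vec d) :
    ‖smoothGrad f σ x‖ ≤ L := by
  have := isProbabilityMeasure_uniformBall (d := d) hσ
  have := norm_integral_le_of_norm_le_const (μ := uniformBall d σ)
    (Eventually.of_forall fun z => norm_gradient_le hf (x + z))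
  rwa [probReal_univ, mul_one] at this

/-- At a point of differentiability the gradient is a Clarke subgradient, by a constant sequence,
and almost every point of the ball is one. The mean of a distribution on a closed convex set stays
in that set; passing to the closure does not change the distance to 0. -/
theorem smoothGrad_mem_closure (hf : LipschitzWith L f) (hσ : 0 < σ) {ε : ℝ} (hε : σ ≤ ε)
    (x : Vec d) : smoothGrad f σ x ∈ closure (clarkeEpsSubdiff f ε x) := by
  have := isProbabilityMeasure_uniformBall (d := d) hσ
  refine (convex_convexHull ℝ _).closure.integral_mem isClosed_closure ?_
    (integrable_gradient_add hf hσ x)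
  filter_upwards [(uniformBall_absolutelyContinuous σ).ae_le (ae_differentiableAt_add hf x),
    ae_uniformBall_norm_le (d := d) σ] with z hz hzσ
  refine subset_closure (subset_convexHull ℝ _ ?_)
  refine mem_iUnion₂.2 ⟨x + z, by simpa using hzσ.trans hε, subset_convexHull ℝ _ ?_⟩
  exact ⟨fun _ => x + z, tendsto_const_nhds, fun _ => hz, tendsto_const_nhds⟩

theorem isStationary_of_norm_smoothGrad_le (hf : LipschitzWith L f) (hσ : 0 < σ) {ε₁ ε₂ : ℝ}
    (hε : σ ≤ ε₁) {x : Vec d} (hx : ‖smoothGrad f σ x‖ ≤ ε₂) : IsStationary f ε₁ ε₂ x := by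
  rw [IsStationary, ← infEDist_closure]
  refine (infEDist_le_edist_of_mem (smoothGrad_mem_closure hf hσ hε x)).trans ?_
  rw [edist_dist, dist_zero_left]
  exact ENNReal.ofReal_le_ofReal hx

/-- Pair the difference `v` of the gradients with itself: ‖v‖² is the ball average of the derivative
along `v` of `h z = f (x + z) - f (y + z)`. Since |h| ≤ L ‖x - y‖, the integration by parts bound
applies. -/
theorem norm_smoothGrad_sub_le (hd : 0 < d) (hf : LipschitzWith L f) (hσ : 0 < σ) (x y : Vec d) :
    ‖smoothGrad f σ x - smoothGrad f σ y‖ ≤ √d * L / σ * ‖x - y‖ := by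
  have : Nonempty (Fin d) := ⟨⟨0, hd⟩⟩
  set v := smoothGrad f σ x - smoothGrad f σ y with hv
  set h : Vec d → ℝ := fun z => f (x + z) - f (y + z) with hh
  have hfx : ∀ x : Vec d, LipschitzWith L fun z => f (x + z) := fun x => by
    simpa [Function.comp_def] using hf.comp (isometry_add_left x).lipschitz
  have hhL : LipschitzWith (L + L) h := (hfx x).sub (hfx y)
  have hB : ∀ z, |h z| ≤ L * ‖x - y‖ := fun z => by
    simpa using hf.norm_sub_le (x + z) (y + z)
  have hV : 0 < volume.real (ball (0 : Vec d) 1) :=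
    ENNReal.toReal_pos (measure_ball_pos _ _ one_pos).ne' measure_ball_lt_top.ne
  have key : ‖v‖ ^ 2 = ∫ z, lineDeriv ℝ h z v ∂uniformBall d σ := by
    rw [← real_inner_self_eq_norm_sq]
    nth_rw 2 [hv]
    have hi : Integrable (fun z => gradient f (x + z) - gradient f (y + z)) (uniformBall d σ) :=
      (integrable_gradient_add hf hσ x).sub (integrable_gradient_add hf hσ y)
    rw [smoothGrad, smoothGrad,
      ← integral_sub (integrable_gradient_add hf hσ x) (integrable_gradient_add hf hσ y),
      ← integral_inner hi]
    refine integral_congr_ae ?_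
    filter_upwards [(uniformBall_absolutelyContinuous σ).ae_le (ae_differentiableAt_add hf x),
      (uniformBall_absolutelyContinuous σ).ae_le (ae_differentiableAt_add hf y)] with z hx hy
    have hg : ∀ x : Vec d, DifferentiableAt ℝ f (x + z) →
        HasGradientAt (fun z => f (x + z)) (gradient f (x + z)) z := fun x hx => by
      rw [hasGradientAt_iff_hasFDerivAt]
      exact (hasFDerivAt_comp_add_left x).2 hx.hasGradientAt.hasFDerivAt
    have h1 : HasFDerivAt h (InnerProductSpace.toDual ℝ _ (gradient f (x + z)) -
        InnerProductSpace.toDual ℝ _ (gradient f (y + z))) z :=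
      (hg x hx).hasFDerivAt.sub (hg y hy).hasFDerivAt
    rw [h1.differentiableAt.lineDeriv_eq_fderiv, h1.fderiv, _root_.sub_apply,
      InnerProductSpace.toDual_apply_apply, InnerProductSpace.toDual_apply_apply,
      ← inner_sub_left, real_inner_comm]
  have h2 : ‖v‖ ^ 2 ≤ √d * L / σ * ‖x - y‖ * ‖v‖ := by
    rw [key, integral_uniformBall hσ]
    have h3 := (le_abs_self _).trans (abs_setIntegral_lineDeriv_le hd hhL hB hσ v)
    calc _ ≤ (σ ^ d * volume.real (ball (0 : Vec d) 1))⁻¹ * _ :=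
          mul_le_mul_of_nonneg_left h3 (by positivity)
      _ = √d * L / σ * ‖x - y‖ * ‖v‖ := by
          obtain ⟨m, rfl⟩ : ∃ m, d = m + 1 := ⟨d - 1, by omega⟩
          rw [Nat.add_sub_cancel]
          field_simp
          ring
  rcases (norm_nonneg v).eq_or_lt with h0 | h0
  · rw [← h0]; positivity
  · nlinarith

theorem continuous_smoothGrad (hd : 0 < d) (hf : LipschitzWith L f) (hσ : 0 < σ) :
    Continuous (smoothGrad f σ) := by
  refine (LipschitzWith.of_dist_le_mul (K := Real.toNNReal (√d * L / σ)) fun x y => ?_).continuous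
  rw [dist_eq_norm, dist_eq_norm, Real.coe_toNNReal _ (by positivity)]
  exact norm_smoothGrad_sub_le hd hf hσ x y

theorem smooth_le (hf : LipschitzWith L f) (hσ : 0 < σ) (x : Vec d) :
    smooth f σ x ≤ f x + L * σ := by
  have := isProbabilityMeasure_uniformBall (d := d) hσ
  have h1 : smooth f σ x ≤ ∫ _, (f x + L * σ) ∂uniformBall d σ := by
    refine integral_mono_ae (integrable_comp_add hf hσ x) (integrable_const _) ?_
    filter_upwards [ae_uniformBall_norm_le (d := d) σ] with z hz
    have h1 := (le_abs_self _).trans (hf.norm_sub_le (x + z) x)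
    rw [add_sub_cancel_left] at h1
    have h2 : (L : ℝ) * ‖z‖ ≤ L * σ := by gcongr
    linarith
  simpa using h1

theorem le_smooth (hf : LipschitzWith L f) (hσ : 0 < σ) {m : ℝ} (hm : ∀ x, m ≤ f x) (x : Vec d) :
    m ≤ smooth f σ x := by
  have := isProbabilityMeasure_uniformBall (d := d) hσ
  have h1 : ∫ _, m ∂uniformBall d σ ≤ smooth f σ x :=
    integral_mono (integrable_const _) (integrable_comp_add hf hσ x) fun z => hm _
  simpa using h1

end

end

section

variable {d p : ℕ}

/-! ### Gradients of Carathéodory functions -/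

/-- A Carathéodory function, as a map into the space of continuous functions with the compact-open
topology, is Borel measurable. -/
theorem measurable_continuousMap_mk {X Ω : Type*} [TopologicalSpace X] [LocallyCompactSpace X]
    [TopologicalSpace.PseudoMetrizableSpace X] [SecondCountableTopology X] [MeasurableSpace Ω] {F : X → Ω → ℝ}
    (hm : ∀ w, Measurable (F w)) (hc : ∀ ξ, Continuous fun w => F w ξ) :
    Measurable[_, borel C(X, ℝ)] fun ξ => (⟨fun w => F w ξ, hc ξ⟩ : C(X, ℝ)) := by
  rw [borel_eq_generateFrom_of_subbasis (α := C(X, ℝ)) rfl]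
  refine measurable_generateFrom ?_
  rintro _ ⟨K, hK, U, hU, rfl⟩
  have hU : IsOpen U := hU
  obtain ⟨t, htK, htc, hKt⟩ := hK.isSeparable.exists_countable_dense_subset
  -- The compact image of `K` lies in the open set `U` iff its distance to the complement is bounded
  -- below. By continuity this can be tested on a countable dense subset of `K`.
  have key : ((fun ξ => (⟨fun w => F w ξ, hc ξ⟩ : C(X, ℝ))) ⁻¹' {φ | MapsTo φ K U}) =
      ⋃ n : ℕ, ⋂ x ∈ t, {ξ | (n : ℝ≥0∞)⁻¹ ≤ infEDist (F x ξ) Uᶜ} := by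
    ext ξ
    have hcont : Continuous fun x => infEDist (F x ξ) Uᶜ := continuous_infEDist.comp (hc ξ)
    simp only [mem_preimage, mem_ofPred_eq, ContinuousMap.coe_mk, mem_iUnion, mem_iInter]
    constructor
    · intro h
      rcases K.eq_empty_or_nonempty with rfl | hne
      · exact ⟨0, fun x hx => absurd (htK hx) (notMem_empty x)⟩
      obtain ⟨x₀, hx₀, hmin⟩ := hK.exists_isMinOn hne hcont.continuousOn
      have hpos : 0 < infEDist (F x₀ ξ) Uᶜ := by
        rw [infEDist_pos_iff_notMem_closure, hU.isClosed_compl.closure_eq]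
        exact fun hn => hn (h hx₀)
      obtain ⟨n, hn⟩ := ENNReal.exists_inv_nat_lt hpos.ne'
      exact ⟨n, fun x hx => hn.le.trans (hmin (htK hx))⟩
    · rintro ⟨n, hn⟩ x hx
      have hcl : IsClosed {x | (n : ℝ≥0∞)⁻¹ ≤ infEDist (F x ξ) Uᶜ} :=
        isClosed_le continuous_const hcont
      have hx' : (n : ℝ≥0∞)⁻¹ ≤ infEDist (F x ξ) Uᶜ :=
        closure_minimal (fun y hy => hn y hy) hcl (hKt hx)
      by_contra hU'
      rw [infEDist_zero_of_mem hU'] at hx'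
      exact absurd hx' (not_le.2 (ENNReal.inv_pos.2 (ENNReal.natCast_ne_top n)))
  rw [key]
  exact MeasurableSet.iUnion fun n => MeasurableSet.biInter htc fun x _ =>
    measurableSet_le measurable_const (measurable_infEDist.comp (hm x))

/-- `F` need not be jointly continuous, but evaluation on C(ℝ^d, ℝ) × ℝ^d is. The set is pulled back
from there along the measurable map ξ ↦ F(·, ξ). -/
theorem measurableSet_differentiableAt {F : Vec d → Vec p → ℝ} (hm : ∀ w, Measurable (F w))
    (hc : ∀ ξ, Continuous fun w => F w ξ) :
    MeasurableSet {q : Vec d × Vec p | DifferentiableAt ℝ (fun w => F w q.2) q.1} := by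
  borelize C(Vec d, ℝ)
  have h1 := measurableSet_of_differentiableAt_with_param ℝ (α := C(Vec d, ℝ)) (E := Vec d)
    (f := fun φ w => φ w) (by exact continuous_eval)
  have h2 : Measurable fun q : Vec d × Vec p =>
      ((⟨fun w => F w q.2, hc q.2⟩ : C(Vec d, ℝ)), q.1) :=
    ((measurable_continuousMap_mk hm hc).comp measurable_snd).prodMk measurable_fst
  exact h2 h1

/-! ### Second moment of a mini-batch average -/

/-- In each coordinate the variance of an average of `n` independent copies is 1/n times the
variance of one, which is at most its second moment. -/
theorem lintegral_norm_avg_sub_sq_le {α : Type*} [MeasurableSpace α] {μ : Measure α}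
    [IsProbabilityMeasure μ] {Y : α → Vec d} (hY : MemLp Y 2 μ) {n : ℕ} (hn : 0 < n) :
    ∫⁻ s, ENNReal.ofReal (‖(n : ℝ)⁻¹ • ∑ l, Y (s l) - ∫ a, Y a ∂μ‖ ^ 2)
        ∂(Measure.pi fun _ : Fin n => μ) ≤ ENNReal.ofReal ((∫ a, ‖Y a‖ ^ 2 ∂μ) / n) := by
  set m := ∫ a, Y a ∂μ with hm
  set ν := Measure.pi fun _ : Fin n => μ with hν
  have hn0 : (n : ℝ) ≠ 0 := by positivity
  have hYj : ∀ j, MemLp (fun a => Y a j) 2 μ := fun j =>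
    (EuclideanSpace.proj (𝕜 := ℝ) j).comp_memLp' hY
  set X : Fin d → (Fin n → α) → ℝ := fun j => ∑ l, fun s => (n : ℝ)⁻¹ * Y (s l) j with hX
  have hXY : ∀ j l, MemLp (fun s : Fin n → α => (n : ℝ)⁻¹ * Y (s l) j) 2 ν := fun j l =>
    ((hYj j).const_mul _).comp_measurePreserving (measurePreserving_eval _ l)
  have hXm : ∀ j, MemLp (X j) 2 ν := fun j => memLp_finsetSum' _ fun l _ => hXY j l
  have hmean : ∀ j, ∫ s, X j s ∂ν = m j := fun j => by
    have h1 : ∀ l, ∫ s, (n : ℝ)⁻¹ * Y (s l) j ∂ν = (n : ℝ)⁻¹ * m j := fun l => by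
      rw [integral_const_mul]
      congr 1
      have h2 := integral_comp_eval (μ := fun _ : Fin n => μ) (i := l) (hYj j).aestronglyMeasurable
      rw [h2]
      exact (EuclideanSpace.proj (𝕜 := ℝ) j).integral_comp_comm (hY.integrable one_le_two)
    simp only [hX, Finset.sum_apply]
    rw [integral_finsetSum _ fun l _ => (hXY j l).integrable one_le_two]
    simp [h1, hn0]
  have hvar : ∀ j, Var[X j; ν] ≤ (n : ℝ)⁻¹ * ∫ a, Y a j ^ 2 ∂μ := fun j => by
    rw [hX, variance_sum_pi fun l => (hYj j).const_mul _]
    simp only [variance_const_mul, Finset.sum_const, Finset.card_univ, Fintype.card_fin,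
      nsmul_eq_mul]
    have := variance_le_expectation_sq (hYj j).aestronglyMeasurable
    calc (n : ℝ) * ((n : ℝ)⁻¹ ^ 2 * Var[fun a => Y a j; μ])
        = (n : ℝ)⁻¹ * Var[fun a => Y a j; μ] := by field_simp
      _ ≤ _ := by gcongr; exact this
  have hpt : ∀ s, ENNReal.ofReal (‖(n : ℝ)⁻¹ • ∑ l, Y (s l) - m‖ ^ 2) =
      ∑ j, ‖X j s - ∫ s, X j s ∂ν‖ₑ ^ 2 := fun s => by
    rw [EuclideanSpace.norm_sq_eq, ENNReal.ofReal_sum_of_nonneg fun _ _ => by positivity]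
    refine Finset.sum_congr rfl fun j _ => ?_
    rw [hmean, ← ofReal_norm, ← ENNReal.ofReal_pow (norm_nonneg _)]
    congr 3
    simp [hX, Finset.mul_sum]
  simp_rw [hpt]
  rw [lintegral_finsetSum' _ fun j _ =>
    ((hXm j).aestronglyMeasurable.aemeasurable.sub_const _).enorm.pow_const _]
  calc ∑ j, ∫⁻ s, ‖X j s - ∫ s, X j s ∂ν‖ₑ ^ 2 ∂ν = ∑ j, ENNReal.ofReal Var[X j; ν] :=
        Finset.sum_congr rfl fun j _ => ((hXm j).ofReal_variance_eq).symm
    _ = ENNReal.ofReal (∑ j, Var[X j; ν]) :=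
        (ENNReal.ofReal_sum_of_nonneg fun j _ => variance_nonneg _ _).symm
    _ ≤ ENNReal.ofReal ((∫ a, ‖Y a‖ ^ 2 ∂μ) / n) := by
        refine ENNReal.ofReal_le_ofReal ((Finset.sum_le_sum fun j _ => hvar j).trans_eq ?_)
        rw [← Finset.mul_sum, ← integral_finsetSum _ fun j _ => (hYj j).integrable_sq,
          div_eq_inv_mul]
        congr 2
        funext a
        rw [EuclideanSpace.norm_sq_eq]
        simp

end

/-! ### The stochastic gradient as an unbiased estimator for the smoothed objective -/

section

variable {d p : ℕ}

namespace Problem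

variable (P : Problem d p)

theorem integrable_C : Integrable P.C P.law := by
  have := P.isProb
  exact P.memLp_C.integrable one_le_two

theorem ae_C_nonneg (hd : 0 < d) : ∀ᵐ ξ ∂P.law, 0 ≤ P.C ξ := by
  filter_upwards [P.lipschitz_F] with ξ hξ
  have h := (abs_nonneg _).trans (hξ (EuclideanSpace.single ⟨0, hd⟩ (1 : ℝ)) 0)
  simpa using h

/-- The variance of C(ξ) is nonnegative. -/
theorem L₀_sq_le_Q : P.L₀ ^ 2 ≤ P.Q := by
  have := P.isProb
  have h := variance_nonneg P.C P.law
  rw [variance_eq_sub P.memLp_C] at h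
  simp only [Pi.pow_apply] at h
  rw [L₀, Q]
  linarith

theorem ae_lipschitzWith : ∀ᵐ ξ ∂P.law, LipschitzWith (P.C ξ).toNNReal fun w => P.F w ξ := by
  filter_upwards [P.lipschitz_F] with ξ hξ
  refine LipschitzWith.of_dist_le_mul fun x y => ?_
  rw [Real.dist_eq, dist_eq_norm]
  exact (hξ x y).trans (by gcongr; exact Real.le_coe_toNNReal _)

theorem lipschitzWith_f (hL : 0 ≤ P.L₀) : LipschitzWith P.L₀.toNNReal P.f := by
  refine LipschitzWith.of_dist_le_mul fun x y => ?_
  rw [Real.dist_eq, dist_eq_norm, Real.coe_toNNReal _ hL, f, f,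
    ← integral_sub (P.integrable_F x) (P.integrable_F y), L₀, ← integral_mul_const,
    ← Real.norm_eq_abs]
  exact norm_integral_le_of_norm_le (P.integrable_C.mul_const _)
    (by filter_upwards [P.lipschitz_F] with ξ hξ using hξ x y)

theorem measurable_uncurry_F : Measurable fun q : Vec d × Vec p => P.F q.1 q.2 := by
  have h := measurable_uncurry_of_continuous_of_measurable (u := fun (w : Vec d) (ξ : Vec p) =>
    P.F w ξ) P.continuous_F P.measurable_F
  exact h

/-- Rademacher's theorem for almost every fixed ξ, and Fubini, which needs the differentiability set
to be measurable. -/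
theorem ae_hasGradientAt (hd : 0 < d) :
    ∀ᵐ q ∂((volume : Measure (Vec d)).prod P.law),
      HasGradientAt (fun w => P.F w q.2) (P.G q.1 q.2) q.1 ∧ ‖P.G q.1 q.2‖ ≤ P.C q.2 := by
  have := P.isProb
  have hmeas := measurableSet_differentiableAt P.measurable_F P.continuous_F
  have hdiff : ∀ᵐ q ∂((volume : Measure (Vec d)).prod P.law),
      DifferentiableAt ℝ (fun w => P.F w q.2) q.1 := by
    have h1 : ∀ᵐ q ∂(P.law.prod (volume : Measure (Vec d))),
        DifferentiableAt ℝ (fun w => P.F w q.1) q.2 := by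
      refine (Measure.ae_prod_iff_ae_ae (p := fun q : Vec p × Vec d =>
        DifferentiableAt ℝ (fun w => P.F w q.1) q.2) (measurable_swap hmeas)).2 ?_
      filter_upwards [P.ae_lipschitzWith] with ξ hξ using hξ.ae_differentiableAt
    exact Measure.measurePreserving_swap.quasiMeasurePreserving.ae h1
  filter_upwards [hdiff, P.G_eq_gradient,
    Measure.quasiMeasurePreserving_snd.ae P.ae_lipschitzWith,
    Measure.quasiMeasurePreserving_snd.ae (P.ae_C_nonneg hd)] with q h1 h2 h3 h4
  rw [h2 h1]
  exact ⟨h1.hasGradientAt, (norm_gradient_le h3 q.1).trans_eq (Real.coe_toNNReal _ h4)⟩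

end Problem

variable (P : Problem d p) {σ : ℝ}

theorem isProbabilityMeasure_sampleLaw (hσ : 0 < σ) : IsProbabilityMeasure (sampleLaw P σ) := by
  have := P.isProb
  have := isProbabilityMeasure_uniformBall (d := d) hσ
  rw [sampleLaw]; infer_instance

/-- The law of x + z is absolutely continuous for every fixed `x`. So statements that hold for
almost every (w, ξ) are available at each iterate, wherever it lies. -/
theorem ae_sampleLaw_of_ae_prod (hσ : 0 < σ) {A : Vec d × Vec p → Prop}
    (hA : ∀ᵐ q ∂((volume : Measure (Vec d)).prod P.law), A q) (x : Vec d) :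
    ∀ᵐ q ∂sampleLaw P σ, A (x + q.1, q.2) := by
  have := P.isProb
  have := isProbabilityMeasure_uniformBall (d := d) hσ
  have h1 := (measurePreserving_add_left (volume : Measure (Vec d)) x).prod
    (MeasurePreserving.id P.law)
  have h2 : sampleLaw P σ ≪ (volume : Measure (Vec d)).prod P.law :=
    (uniformBall_absolutelyContinuous σ).prod Measure.AbsolutelyContinuous.rfl
  exact h2.ae_le (h1.quasiMeasurePreserving.ae hA)

theorem ae_sampleLaw_snd (hσ : 0 < σ) {A : Vec p → Prop} (hA : ∀ᵐ ξ ∂P.law, A ξ) :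
    ∀ᵐ q ∂sampleLaw P σ, A q.2 := by
  have := P.isProb
  have := isProbabilityMeasure_uniformBall (d := d) hσ
  exact Measure.quasiMeasurePreserving_snd.ae hA

theorem ae_sampleLaw_fst (hσ : 0 < σ) {A : Vec d → Prop} (hA : ∀ᵐ z ∂uniformBall d σ, A z) :
    ∀ᵐ q ∂sampleLaw P σ, A q.1 := by
  have := P.isProb
  have := isProbabilityMeasure_uniformBall (d := d) hσ
  exact Measure.quasiMeasurePreserving_fst.ae hA

theorem measurable_G_add (x : Vec d) :
    Measurable fun q : Vec d × Vec p => P.G (x + q.1) q.2 :=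
  P.measurable_G.comp ((measurable_fst.const_add x).prodMk measurable_snd)

theorem memLp_C_snd (hσ : 0 < σ) : MemLp (fun q : Vec d × Vec p => P.C q.2) 2 (sampleLaw P σ) := by
  have := P.isProb
  have := isProbabilityMeasure_uniformBall (d := d) hσ
  exact P.memLp_C.comp_measurePreserving measurePreserving_snd

theorem ae_norm_G_le (hd : 0 < d) (hσ : 0 < σ) (x : Vec d) :
    ∀ᵐ q ∂sampleLaw P σ, ‖P.G (x + q.1) q.2‖ ≤ P.C q.2 := by
  filter_upwards [ae_sampleLaw_of_ae_prod P hσ (P.ae_hasGradientAt hd) x] with q hq using hq.2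

theorem memLp_G (hd : 0 < d) (hσ : 0 < σ) (x : Vec d) :
    MemLp (fun q : Vec d × Vec p => P.G (x + q.1) q.2) 2 (sampleLaw P σ) :=
  (memLp_C_snd P hσ).mono' (measurable_G_add P x).aestronglyMeasurable (ae_norm_G_le P hd hσ x)

theorem integral_norm_G_sq_le (hd : 0 < d) (hσ : 0 < σ) (x : Vec d) :
    ∫ q, ‖P.G (x + q.1) q.2‖ ^ 2 ∂sampleLaw P σ ≤ P.Q := by
  have := P.isProb
  have := isProbabilityMeasure_uniformBall (d := d) hσ
  have := isProbabilityMeasure_sampleLaw P hσ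
  have h1 : ∫ q, P.C q.2 ^ 2 ∂sampleLaw P σ = P.Q := by
    rw [sampleLaw, integral_fun_snd (fun ξ => P.C ξ ^ 2)]; simp [Problem.Q]
  rw [← h1]
  refine integral_mono_ae ((memLp_G P hd hσ x).integrable_norm_pow two_ne_zero)
    (memLp_C_snd P hσ).integrable_sq ?_
  filter_upwards [ae_norm_G_le P hd hσ x] with q hq
  exact pow_le_pow_left₀ (norm_nonneg _) hq 2

theorem integrable_F_add (hσ : 0 < σ) (x : Vec d) :
    Integrable (fun q : Vec d × Vec p => P.F (x + q.1) q.2) (sampleLaw P σ) := by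
  have := P.isProb
  have := isProbabilityMeasure_uniformBall (d := d) hσ
  have := isProbabilityMeasure_sampleLaw P hσ
  have h1 : Integrable (fun q : Vec d × Vec p => |P.F x q.2| + |P.C q.2| * σ) (sampleLaw P σ) :=
    ((P.integrable_F x).abs.comp_snd _).add
      (((memLp_C_snd P hσ).integrable one_le_two).abs.mul_const σ)
  refine h1.mono' (P.measurable_uncurry_F.comp
    ((measurable_fst.const_add x).prodMk measurable_snd)).aestronglyMeasurable ?_
  filter_upwards [ae_sampleLaw_snd P hσ P.lipschitz_F,
    ae_sampleLaw_fst P hσ (ae_uniformBall_norm_le (d := d) σ)] with q hq hz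
  have h2 := hq (x + q.1) x
  rw [add_sub_cancel_left] at h2
  have h3 : P.C q.2 * ‖q.1‖ ≤ |P.C q.2| * σ :=
    mul_le_mul (le_abs_self _) hz (norm_nonneg _) (abs_nonneg _)
  have h4 := abs_sub_abs_le_abs_sub (P.F (x + q.1) q.2) (P.F x q.2)
  rw [Real.norm_eq_abs]
  linarith

theorem integral_F_add (hσ : 0 < σ) (x : Vec d) :
    ∫ q, P.F (x + q.1) q.2 ∂sampleLaw P σ = smooth P.f σ x := by
  have := P.isProb
  have := isProbabilityMeasure_uniformBall (d := d) hσ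
  exact integral_prod _ (integrable_F_add P hσ x)

/-- Both sides are the gradient at `x` of the same function E F(y + z, ξ) = f_σ(y): one
differentiates under the joint expectation, the other after integrating out ξ. -/
theorem integral_G_add (hd : 0 < d) (hL : 0 ≤ P.L₀) (hσ : 0 < σ) (x : Vec d) :
    ∫ q, P.G (x + q.1) q.2 ∂sampleLaw P σ = smoothGrad P.f σ x := by
  have := P.isProb
  have := isProbabilityMeasure_uniformBall (d := d) hσ
  have := isProbabilityMeasure_sampleLaw P hσ
  have h1 : HasGradientAt (fun y => ∫ q, P.F (y + q.1) q.2 ∂sampleLaw P σ)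
      (∫ q, P.G (x + q.1) q.2 ∂sampleLaw P σ) x := by
    refine hasGradientAt_integral (C := fun q => P.C q.2)
      (fun y => (integrable_F_add P hσ y).aestronglyMeasurable) (integrable_F_add P hσ x)
      (memLp_G P hd hσ x).aestronglyMeasurable ((memLp_C_snd P hσ).integrable one_le_two)
      ?_ ?_ ((memLp_G P hd hσ x).integrable one_le_two)
    · filter_upwards [ae_sampleLaw_snd P hσ P.lipschitz_F] with q hq y
      simpa using hq (y + q.1) (x + q.1)
    · filter_upwards [ae_sampleLaw_of_ae_prod P hσ (P.ae_hasGradientAt hd) x] with q hq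
      rw [hasGradientAt_iff_hasFDerivAt]
      exact (hasFDerivAt_comp_add_right (f := fun w => P.F w q.2) q.1).2 hq.1.hasFDerivAt
  simp_rw [integral_F_add P hσ] at h1
  exact h1.unique (hasGradientAt_smooth (P.lipschitzWith_f hL) hσ x)

theorem avgGrad_fst (G : Vec d → Vec p → Vec d) {n : ℕ} (s : Fin n → Vec d × Vec p) (x : Vec d) :
    (avgGrad G s x).1 = (n : ℝ)⁻¹ • ∑ l, G (x + (s l).1) (s l).2 := rfl

theorem lintegral_norm_avgGrad_sub_sq_le (hd : 0 < d) (hL : 0 ≤ P.L₀) (hσ : 0 < σ) {n : ℕ}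
    (hn : 0 < n) (x : Vec d) :
    ∫⁻ s, ENNReal.ofReal (‖(avgGrad P.G s x).1 - smoothGrad P.f σ x‖ ^ 2)
        ∂(Measure.pi fun _ : Fin n => sampleLaw P σ) ≤ ENNReal.ofReal (P.Q / n) := by
  have := isProbabilityMeasure_sampleLaw P hσ
  have h := lintegral_norm_avg_sub_sq_le (memLp_G P hd hσ x) hn
  rw [integral_G_add P hd hL hσ x] at h
  refine h.trans (ENNReal.ofReal_le_ofReal ?_)
  gcongr
  exact integral_norm_G_sq_le P hd hσ x

/-- One step with the step size `σ / (√d L₀)`, the inverse of the Lipschitz constant of the gradient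
of the smoothed function. -/
theorem smooth_step_le (hd : 0 < d) (hL : 0 < P.L₀) (hσ : 0 < σ) {η : ℝ}
    (hη : η = σ / (√d * P.L₀)) (x a : Vec d) :
    smooth P.f σ (x - η • a) + η / 2 * ‖smoothGrad P.f σ x‖ ^ 2 ≤
      smooth P.f σ x + η / 2 * ‖a - smoothGrad P.f σ x‖ ^ 2 := by
  have hlip := P.lipschitzWith_f hL.le
  have h := le_add_inner_add_sq (fun y => hasGradientAt_smooth hlip hσ y)
    (fun y z => norm_smoothGrad_sub_le hd hlip hσ y z) x (-(η • a))
  rw [← sub_eq_add_neg, norm_neg, norm_smul, inner_neg_right, real_inner_smul_right,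
    Real.coe_toNNReal _ hL.le] at h
  have hη0 : 0 < η := by rw [hη]; positivity
  -- With this step size the quadratic term of the descent lemma is η/2 ‖a‖², which completes the
  -- square with the inner product term.
  have h1 : √d * P.L₀ / σ * η = 1 := by
    have : (0 : ℝ) < √d := by positivity
    rw [hη]; field_simp
  rw [Real.norm_of_nonneg hη0.le, mul_pow] at h
  have h2 : √d * P.L₀ / σ / 2 * (η ^ 2 * ‖a‖ ^ 2) = η / 2 * ‖a‖ ^ 2 := by
    calc _ = (√d * P.L₀ / σ * η) * (η / 2 * ‖a‖ ^ 2) := by ring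
      _ = _ := by rw [h1, one_mul]
  rw [h2] at h
  rw [norm_sub_sq_real, real_inner_comm]
  nlinarith

end

section

variable {d p : ℕ}

/-! ### Measurability of the algorithm -/

theorem measurable_avgGrad {G : Vec d → Vec p → Vec d}
    (hG : Measurable fun q : Vec d × Vec p => G q.1 q.2) (n : ℕ) :
    Measurable fun q : (Fin n → Vec d × Vec p) × Vec d => (avgGrad G q.1 q.2).1 := by
  simp only [avgGrad_fst]
  have h (l : Fin n) : Measurable fun q : (Fin n → Vec d × Vec p) × Vec d =>
      G (q.2 + (q.1 l).1) (q.1 l).2 := by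
    have h1 : Measurable fun q : (Fin n → Vec d × Vec p) × Vec d => q.1 l :=
      (measurable_pi_apply l).comp measurable_fst
    have h2 : Measurable fun q : (Fin n → Vec d × Vec p) × Vec d => q.2 + (q.1 l).1 :=
      measurable_snd.add (measurable_fst.comp h1)
    exact hG.comp (h2.prodMk (measurable_snd.comp h1))
  exact (Finset.measurable_fun_sum Finset.univ fun l _ => h l).const_smul (n : ℝ)⁻¹

theorem iterate_succ_fst (G : Vec d → Vec p → Vec d) (η : ℝ) {S : ℕ} (x₁ : Vec d) (n : ℕ)
    (s : Fin (n + 1) → Fin S → Vec d × Vec p) :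
    (iterate G η x₁ (n + 1) s).1 = (iterate G η x₁ n fun k => s k.castSucc).1 -
      η • (avgGrad G (s (Fin.last n)) (iterate G η x₁ n fun k => s k.castSucc).1).1 := rfl

theorem measurable_iterate {G : Vec d → Vec p → Vec d}
    (hG : Measurable fun q : Vec d × Vec p => G q.1 q.2) (η : ℝ) (S : ℕ) (x₁ : Vec d) (n : ℕ) :
    Measurable fun s : Fin n → Fin S → Vec d × Vec p => (iterate G η x₁ n s).1 := by
  induction n with
  | zero => exact measurable_const
  | succ n ih =>
    simp only [iterate_succ_fst]
    have h1 : Measurable fun s : Fin (n + 1) → Fin S → Vec d × Vec p =>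
        (iterate G η x₁ n fun k => s k.castSucc).1 :=
      ih.comp (measurable_pi_lambda _ fun k => measurable_pi_apply _)
    exact h1.sub (((measurable_avgGrad hG S).comp
      ((measurable_pi_apply (Fin.last n)).prodMk h1)).const_smul η)

theorem measurable_run {G : Vec d → Vec p → Vec d}
    (hG : Measurable fun q : Vec d × Vec p => G q.1 q.2) (η : ℝ) (K S : ℕ) (x₁ : Vec d) :
    Measurable fun D : RunDraws d p K S => (run G η x₁ D).1 := by
  refine measurable_from_prod_countable_right fun r => ?_
  exact (measurable_iterate hG η S x₁ r).comp
    (measurable_pi_lambda _ fun k => measurable_pi_apply (k.castLE (Nat.le_sub_one_of_lt r.isLt)))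

/-! ### Expected decrease of the smoothed function -/

variable (P : Problem d p)

/-- The law of one batch of `S` samples. -/
noncomputable abbrev batchLaw (σ : ℝ) (S : ℕ) : Measure (Fin S → Vec d × Vec p) :=
  Measure.pi fun _ => sampleLaw P σ

/-- The law of `n` independent batches of `S` samples. -/
noncomputable abbrev batchesLaw (σ : ℝ) (S n : ℕ) : Measure (Fin n → Fin S → Vec d × Vec p) :=
  Measure.pi fun _ => batchLaw P σ S

/-- The law of the draws of one run. -/
noncomputable abbrev runLaw (σ : ℝ) (S K : ℕ) : Measure (RunDraws d p K S) :=
  (uniformOn (Set.univ : Set (Fin K))).prod (batchesLaw P σ S (K - 1))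

variable {σ η m : ℝ} {S : ℕ}

theorem isProbabilityMeasure_batchLaw (hσ : 0 < σ) (S : ℕ) :
    IsProbabilityMeasure (batchLaw P σ S) := by
  have := isProbabilityMeasure_sampleLaw P hσ
  infer_instance

theorem isProbabilityMeasure_batchesLaw (hσ : 0 < σ) (S n : ℕ) :
    IsProbabilityMeasure (batchesLaw P σ S n) := by
  have := isProbabilityMeasure_batchLaw P hσ S
  infer_instance

theorem isProbabilityMeasure_runLaw (hσ : 0 < σ) (S : ℕ) {K : ℕ} (hK : 0 < K) :
    IsProbabilityMeasure (runLaw P σ S K) := by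
  have := isProbabilityMeasure_batchesLaw P hσ S (K - 1)
  have : Nonempty (Fin K) := ⟨⟨0, hK⟩⟩
  have : IsProbabilityMeasure (uniformOn (Set.univ : Set (Fin K))) :=
    isProbabilityMeasure_uniformOn finite_univ univ_nonempty
  infer_instance

/-- Subtracting the lower bound `m` makes the values nonnegative. In additive form the descent
inequality can then be integrated in `ℝ≥0∞`, without any integrability of the iterates. -/
theorem lintegral_step_le (hd : 0 < d) (hL : 0 < P.L₀) (hσ : 0 < σ) (hη : η = σ / (√d * P.L₀))
    (hm : ∀ x, m ≤ P.f x) (hS : 0 < S) (x : Vec d) :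
    ∫⁻ a, ENNReal.ofReal (smooth P.f σ (x - η • (avgGrad P.G a x).1) - m) ∂batchLaw P σ S +
        ENNReal.ofReal (η / 2) * ENNReal.ofReal (‖smoothGrad P.f σ x‖ ^ 2) ≤
      ENNReal.ofReal (smooth P.f σ x - m) + ENNReal.ofReal (η / 2) * ENNReal.ofReal (P.Q / S) := by
  have := isProbabilityMeasure_batchLaw P hσ S
  have hη0 : 0 < η := by rw [hη]; positivity
  have hlip := P.lipschitzWith_f hL.le
  have hsm : ∀ y, 0 ≤ smooth P.f σ y - m := fun y => sub_nonneg.2 (le_smooth hlip hσ hm y)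
  have hpt : ∀ a : Fin S → Vec d × Vec p, ENNReal.ofReal (smooth P.f σ (x - η • (avgGrad P.G a x).1) - m) +
      ENNReal.ofReal (η / 2) * ENNReal.ofReal (‖smoothGrad P.f σ x‖ ^ 2) ≤
      ENNReal.ofReal (smooth P.f σ x - m) + ENNReal.ofReal (η / 2) *
        ENNReal.ofReal (‖(avgGrad P.G a x).1 - smoothGrad P.f σ x‖ ^ 2) := fun a => by
    rw [← ENNReal.ofReal_mul (by positivity), ← ENNReal.ofReal_mul (by positivity),
      ← ENNReal.ofReal_add (hsm _) (by positivity), ← ENNReal.ofReal_add (hsm _) (by positivity)]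
    refine ENNReal.ofReal_le_ofReal ?_
    have := smooth_step_le P hd hL hσ hη x (avgGrad P.G a x).1
    linarith
  have h := lintegral_mono (μ := batchLaw P σ S) hpt
  rw [lintegral_add_right _ measurable_const, lintegral_add_left measurable_const,
    lintegral_const, lintegral_const, measure_univ, mul_one, mul_one,
    lintegral_const_mul' _ _ ENNReal.ofReal_ne_top] at h
  refine h.trans ?_
  gcongr
  exact lintegral_norm_avgGrad_sub_sq_le P hd hL.le hσ hS x

/-- The last batch is independent of the earlier ones, which determine the current iterate; this is
Tonelli after splitting off the last coordinate. -/
theorem lintegral_iterate_succ (hσ : 0 < σ) (x₁ : Vec d) {φ : Vec d → ℝ≥0∞} (hφ : Measurable φ)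
    (n : ℕ) :
    ∫⁻ s, φ (iterate P.G η x₁ (n + 1) s).1 ∂batchesLaw P σ S (n + 1) =
      ∫⁻ s, ∫⁻ a, φ ((iterate P.G η x₁ n s).1 - η • (avgGrad P.G a (iterate P.G η x₁ n s).1).1)
        ∂batchLaw P σ S ∂batchesLaw P σ S n := by
  have := isProbabilityMeasure_batchLaw P hσ S
  have hmp := measurePreserving_piFinSuccAbove (fun _ : Fin (n + 1) => batchLaw P σ S) (Fin.last n)
  have hmeas : Measurable fun q : (Fin S → Vec d × Vec p) × (Fin n → Fin S → Vec d × Vec p) =>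
      φ ((iterate P.G η x₁ n q.2).1 -
        η • (avgGrad P.G q.1 (iterate P.G η x₁ n q.2).1).1) := by
    have h1 : Measurable fun q : (Fin S → Vec d × Vec p) × (Fin n → Fin S → Vec d × Vec p) =>
        (iterate P.G η x₁ n q.2).1 := (measurable_iterate P.measurable_G η S x₁ n).comp measurable_snd
    exact hφ.comp (h1.sub (((measurable_avgGrad P.measurable_G S).comp
      (measurable_fst.prodMk h1)).const_smul η))
  rw [← lintegral_prod_symm' _ hmeas, ← hmp.lintegral_comp hmeas]
  refine lintegral_congr fun s => ?_
  rw [iterate_succ_fst]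
  simp only [MeasurableEquiv.piFinSuccAbove, Fin.insertNthEquiv]
  simp
  rfl

theorem lintegral_iterate_recursion (hd : 0 < d) (hL : 0 < P.L₀) (hσ : 0 < σ)
    (hη : η = σ / (√d * P.L₀)) (hm : ∀ x, m ≤ P.f x) (hS : 0 < S) (x₁ : Vec d) (n : ℕ) :
    ∫⁻ s, ENNReal.ofReal (smooth P.f σ (iterate P.G η x₁ (n + 1) s).1 - m)
          ∂batchesLaw P σ S (n + 1) +
        ENNReal.ofReal (η / 2) * ∫⁻ s, ENNReal.ofReal
          (‖smoothGrad P.f σ (iterate P.G η x₁ n s).1‖ ^ 2) ∂batchesLaw P σ S n ≤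
      ∫⁻ s, ENNReal.ofReal (smooth P.f σ (iterate P.G η x₁ n s).1 - m) ∂batchesLaw P σ S n +
        ENNReal.ofReal (η / 2) * ENNReal.ofReal (P.Q / S) := by
  have := isProbabilityMeasure_batchesLaw P hσ S n
  have hlip := P.lipschitzWith_f hL.le
  have hcont : Continuous (smooth P.f σ) := continuous_iff_continuousAt.2 fun x =>
    (hasGradientAt_smooth hlip hσ x).hasFDerivAt.continuousAt
  have hφ : Measurable fun x => ENNReal.ofReal (smooth P.f σ x - m) :=
    (hcont.measurable.sub_const m).ennreal_ofReal
  have hb : Measurable fun x => ENNReal.ofReal (‖smoothGrad P.f σ x‖ ^ 2) :=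
    ((continuous_smoothGrad hd hlip hσ).norm.pow 2).measurable.ennreal_ofReal
  have hit := measurable_iterate P.measurable_G η S x₁ n
  have hbit : Measurable fun s : Fin n → Fin S → Vec d × Vec p => ENNReal.ofReal (η / 2) *
      ENNReal.ofReal (‖smoothGrad P.f σ (iterate P.G η x₁ n s).1‖ ^ 2) :=
    (hb.comp hit).const_mul _
  rw [lintegral_iterate_succ P hσ x₁ hφ, ← lintegral_const_mul' _ _ ENNReal.ofReal_ne_top,
    ← lintegral_add_right _ hbit]
  refine (lintegral_mono fun s => lintegral_step_le P hd hL hσ hη hm hS _).trans_eq ?_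
  rw [lintegral_add_right _ measurable_const, lintegral_const, measure_univ, mul_one]

theorem sum_lintegral_iterate_le (hd : 0 < d) (hL : 0 < P.L₀) (hσ : 0 < σ)
    (hη : η = σ / (√d * P.L₀)) (hm : ∀ x, m ≤ P.f x) (hS : 0 < S) (x₁ : Vec d) (K : ℕ) :
    ENNReal.ofReal (η / 2) * ∑ n ∈ Finset.range K, ∫⁻ s, ENNReal.ofReal
        (‖smoothGrad P.f σ (iterate P.G η x₁ n s).1‖ ^ 2) ∂batchesLaw P σ S n ≤
      ENNReal.ofReal (smooth P.f σ x₁ - m) +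
        K * (ENNReal.ofReal (η / 2) * ENNReal.ofReal (P.Q / S)) := by
  have := isProbabilityMeasure_batchesLaw P hσ S 0
  -- The value at the last iterate is kept on the left so that the induction telescopes.
  suffices h : ∫⁻ s, ENNReal.ofReal (smooth P.f σ (iterate P.G η x₁ K s).1 - m)
      ∂batchesLaw P σ S K + ENNReal.ofReal (η / 2) * ∑ n ∈ Finset.range K, ∫⁻ s, ENNReal.ofReal
        (‖smoothGrad P.f σ (iterate P.G η x₁ n s).1‖ ^ 2) ∂batchesLaw P σ S n ≤
      ENNReal.ofReal (smooth P.f σ x₁ - m) +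
        K * (ENNReal.ofReal (η / 2) * ENNReal.ofReal (P.Q / S)) from le_add_self.trans h
  induction K with
  | zero => simp [iterate]
  | succ K ih =>
    rw [Finset.sum_range_succ, mul_add, add_left_comm, Nat.cast_succ, add_mul, one_mul]
    have h := lintegral_iterate_recursion P hd hL hσ hη hm hS x₁ K
    calc _ ≤ _ := add_le_add_right h _
      _ ≤ _ := by rw [← add_assoc, ← add_assoc, add_comm (_ * _) (lintegral _ _)]; gcongr

/-- Given the index `r`, the first `r` of the `K - 1` batches again form a product law; the uniform
index turns the expectation into the average over the iterates. -/
theorem lintegral_run_eq (hσ : 0 < σ) (x₁ : Vec d) {φ : Vec d → ℝ≥0∞} (hφ : Measurable φ)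
    {K : ℕ} (hK : 0 < K) :
    K * ∫⁻ D, φ (run P.G η x₁ D).1 ∂runLaw P σ S K =
      ∑ n ∈ Finset.range K, ∫⁻ s, φ (iterate P.G η x₁ n s).1 ∂batchesLaw P σ S n := by
  have := isProbabilityMeasure_batchLaw P hσ S
  have hrun : Measurable fun D : RunDraws d p K S => φ (run P.G η x₁ D).1 :=
    hφ.comp (measurable_run P.measurable_G η K S x₁)
  rw [runLaw, lintegral_prod _ hrun.aemeasurable, uniformOn, ProbabilityTheory.cond,
    Measure.restrict_univ, lintegral_smul_measure, lintegral_count, tsum_fintype,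
    Measure.count_univ, smul_eq_mul, ← mul_assoc]
  have hK0 : (K : ℝ≥0∞) ≠ 0 := by exact_mod_cast hK.ne'
  simp only [ENat.card_eq_coe_fintype_card, Fintype.card_fin, ENat.toENNReal_coe]
  rw [ENNReal.mul_inv_cancel hK0 (ENNReal.natCast_ne_top K), one_mul, Finset.sum_range]
  refine Finset.sum_congr rfl fun r _ => ?_
  have hle : (r : ℕ) ≤ K - 1 := Nat.le_sub_one_of_lt r.isLt
  have hmp : MeasurePreserving
      (fun (s : Fin (K - 1) → Fin S → Vec d × Vec p) (k : Fin r) => s (k.castLE hle))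
      (batchesLaw P σ S (K - 1)) (batchesLaw P σ S r) := by
    refine ⟨measurable_pi_lambda _ fun k => measurable_pi_apply _, ?_⟩
    have h1 := (iIndepFun_pi (μ := fun _ : Fin (K - 1) => batchLaw P σ S)
      (X := fun _ => id) fun _ => aemeasurable_id).precomp (Fin.castLE_injective hle)
    have h2 := (iIndepFun_iff_map_fun_eq_pi_map
      fun k => (measurable_pi_apply (Fin.castLE hle k)).aemeasurable).1 h1
    refine h2.trans ?_
    congr 1
    funext k
    exact (measurePreserving_eval (fun _ : Fin (K - 1) => batchLaw P σ S) _).map_eq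
  exact hmp.lintegral_comp (hφ.comp (measurable_iterate P.measurable_G η S x₁ r))

/-- The expected squared gradient norm of the smoothed function at the output of a run. -/
theorem lintegral_run_le (hd : 0 < d) (hL : 0 < P.L₀) (hσ : 0 < σ)
    (hη : η = σ / (√d * P.L₀)) {xmin : Vec d} (hm : ∀ x, P.f xmin ≤ P.f x) (hS : 0 < S)
    (x₁ : Vec d) {K : ℕ} (hK : 0 < K) :
    ∫⁻ D, ENNReal.ofReal (‖smoothGrad P.f σ (run P.G η x₁ D).1‖ ^ 2) ∂runLaw P σ S K ≤
      ENNReal.ofReal (2 * (P.f x₁ - P.f xmin + P.L₀ * σ) / (K * η) + P.Q / S) := by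
  have hlip := P.lipschitzWith_f hL.le
  have hη0 : 0 < η := by rw [hη]; positivity
  have hQ : 0 ≤ P.Q := (sq_nonneg _).trans P.L₀_sq_le_Q
  have hΔ : 0 ≤ P.f x₁ - P.f xmin + P.L₀ * σ := by
    have := hm x₁
    have : 0 < P.L₀ * σ := by positivity
    linarith
  have hb : Measurable fun x => ENNReal.ofReal (‖smoothGrad P.f σ x‖ ^ 2) :=
    ((continuous_smoothGrad hd hlip hσ).norm.pow 2).measurable.ennreal_ofReal
  have h1 := sum_lintegral_iterate_le P hd hL hσ hη hm hS x₁ K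
  rw [← lintegral_run_eq P hσ x₁ hb hK] at h1
  have hc : ENNReal.ofReal (η / 2) * (K : ℝ≥0∞) = ENNReal.ofReal (η / 2 * K) := by
    rw [ENNReal.ofReal_mul (by positivity), ENNReal.ofReal_natCast]
  have h2 : ENNReal.ofReal (smooth P.f σ x₁ - P.f xmin) +
      K * (ENNReal.ofReal (η / 2) * ENNReal.ofReal (P.Q / S)) ≤
      ENNReal.ofReal (η / 2 * K) *
        ENNReal.ofReal (2 * (P.f x₁ - P.f xmin + P.L₀ * σ) / (K * η) + P.Q / S) := by
    rw [← mul_assoc, mul_comm (K : ℝ≥0∞), hc, ← ENNReal.ofReal_mul (by positivity),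
      ← ENNReal.ofReal_mul (by positivity), ← ENNReal.ofReal_add
        (sub_nonneg.2 (le_smooth hlip hσ hm x₁)) (by positivity)]
    refine ENNReal.ofReal_le_ofReal ?_
    have h3 := smooth_le hlip hσ x₁
    rw [Real.coe_toNNReal _ hL.le] at h3
    have h4 : η / 2 * K * (2 * (P.f x₁ - P.f xmin + P.L₀ * σ) / (K * η) + P.Q / S) =
        (P.f x₁ - P.f xmin + P.L₀ * σ) + η / 2 * K * (P.Q / S) := by
      field_simp
    rw [h4]
    linarith
  have h3 := h1.trans h2
  rw [← mul_assoc, hc] at h3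
  exact (ENNReal.mul_le_mul_iff_right (by simpa using by positivity) ENNReal.ofReal_ne_top).1 h3

end

section

variable {d p : ℕ}

/-! ### The selection among the candidates -/

theorem measure_lt_le_of_lintegral_le {α : Type*} [MeasurableSpace α] {μ : Measure α} {X : α → ℝ}
    {a b : ℝ} (hb : 0 < b) (h : ∫⁻ x, ENNReal.ofReal (X x) ∂μ ≤ ENNReal.ofReal a)
    (hX : Measurable X) : μ {x | b < X x} ≤ ENNReal.ofReal (a / b) := by
  calc μ {x | b < X x} ≤ μ {x | ENNReal.ofReal b ≤ ENNReal.ofReal (X x)} :=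
        measure_mono fun x hx => ENNReal.ofReal_le_ofReal (le_of_lt hx)
    _ ≤ (∫⁻ x, ENNReal.ofReal (X x) ∂μ) / ENNReal.ofReal b :=
        meas_ge_le_lintegral_div hX.ennreal_ofReal.aemeasurable (by simpa using hb)
          ENNReal.ofReal_ne_top
    _ ≤ ENNReal.ofReal a / ENNReal.ofReal b := by gcongr
    _ = ENNReal.ofReal (a / b) := (ENNReal.ofReal_div_of_pos hb).symm

/-- The triangle inequality through the smaller estimate gives ‖g x‖ ≤ ‖g y‖ + ‖h y - g y‖ + ‖h x -
g x‖. Then (p + q + r)² ≤ 2(p + q)² + 2r² ≤ 4p² + 4q² + 2r², and the two errors together cost 6b. -/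
theorem norm_sq_le_of_selected {g h : Vec d → Vec d} {x y : Vec d} {a b : ℝ}
    (hsel : ‖h x‖ ≤ ‖h y‖) (hy : ‖g y‖ ^ 2 ≤ a) (hx' : ‖h x - g x‖ ^ 2 ≤ b)
    (hy' : ‖h y - g y‖ ^ 2 ≤ b) : ‖g x‖ ^ 2 ≤ 4 * a + 6 * b := by
  have h1 : ‖g x‖ ≤ ‖h x‖ + ‖h x - g x‖ := by
    have := norm_sub_le (h x) (h x - g x)
    rwa [sub_sub_cancel] at this
  have h2 : ‖h y‖ ≤ ‖h y - g y‖ + ‖g y‖ := by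
    have := norm_add_le (h y - g y) (g y)
    rwa [sub_add_cancel] at this
  have h3 : ‖g x‖ ≤ ‖g y‖ + ‖h y - g y‖ + ‖h x - g x‖ := by linarith
  have h4 : ‖g x‖ ^ 2 ≤ (‖g y‖ + ‖h y - g y‖ + ‖h x - g x‖) ^ 2 :=
    pow_le_pow_left₀ (norm_nonneg _) h3 2
  nlinarith [sq_nonneg (‖g y‖ + ‖h y - g y‖ - ‖h x - g x‖), sq_nonneg (‖g y‖ - ‖h y - g y‖)]

variable (P : Problem d p)

/-- The draws for which one of the candidates has a small smoothed gradient and all estimates of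
smoothed gradients at the candidates are accurate. -/
def goodDraws (x₁ : Vec d) (m : Settings) (a b : ℝ) : Set (Draws d p m) :=
  {D | (∃ i, ‖smoothGrad P.f m.σ (run P.G m.η x₁ (D.1 i)).1‖ ^ 2 ≤ a) ∧
    ∀ i, ‖(avgGrad P.G D.2 (run P.G m.η x₁ (D.1 i)).1).1 -
      smoothGrad P.f m.σ (run P.G m.η x₁ (D.1 i)).1‖ ^ 2 ≤ b}

theorem norm_smoothGrad_sq_le_of_mem_goodDraws {x₁ : Vec d} {m : Settings} {a b : ℝ}
    {D : Draws d p m} (hD : D ∈ goodDraws P x₁ m a b) {x : Vec d}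
    (hx : x ∈ selected P.G x₁ D) : ‖smoothGrad P.f m.σ x‖ ^ 2 ≤ 4 * a + 6 * b := by
  obtain ⟨⟨i, hi⟩, hall⟩ := hD
  obtain ⟨⟨j, rfl⟩, hsel⟩ := hx
  exact norm_sq_le_of_selected (h := fun x => (avgGrad P.G D.2 x).1) (hsel _ ⟨i, rfl⟩) hi
    (hall j) (hall i)

variable (x₁ : Vec d) (m : Settings)

theorem measurable_runs (i : Fin m.runs) :
    Measurable fun D : Draws d p m => (run P.G m.η x₁ (D.1 i)).1 :=
  (measurable_run P.measurable_G m.η m.K m.S x₁).comp ((measurable_pi_apply i).comp measurable_fst)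

theorem measurable_smoothGrad_runs (hd : 0 < d) (hL : 0 ≤ P.L₀) (hσ : 0 < m.σ) (i : Fin m.runs) :
    Measurable fun D : Draws d p m => smoothGrad P.f m.σ (run P.G m.η x₁ (D.1 i)).1 :=
  (continuous_smoothGrad hd (P.lipschitzWith_f hL) hσ).measurable.comp (measurable_runs P x₁ m i)

theorem measurable_error (hd : 0 < d) (hL : 0 ≤ P.L₀) (hσ : 0 < m.σ) (i : Fin m.runs) :
    Measurable fun D : Draws d p m => ‖(avgGrad P.G D.2 (run P.G m.η x₁ (D.1 i)).1).1 -
      smoothGrad P.f m.σ (run P.G m.η x₁ (D.1 i)).1‖ ^ 2 :=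
  ((((measurable_avgGrad P.measurable_G m.T).comp
    (measurable_snd.prodMk (measurable_runs P x₁ m i))).sub
      (measurable_smoothGrad_runs P x₁ m hd hL hσ i)).norm.pow_const 2)

theorem measurableSet_goodDraws (hd : 0 < d) (hL : 0 ≤ P.L₀) (hσ : 0 < m.σ) (a b : ℝ) :
    MeasurableSet (goodDraws P x₁ m a b) := by
  have h1 : goodDraws P x₁ m a b =
      (⋃ i, {D : Draws d p m | ‖smoothGrad P.f m.σ (run P.G m.η x₁ (D.1 i)).1‖ ^ 2 ≤ a}) ∩
      ⋂ i, {D : Draws d p m | ‖(avgGrad P.G D.2 (run P.G m.η x₁ (D.1 i)).1).1 -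
        smoothGrad P.f m.σ (run P.G m.η x₁ (D.1 i)).1‖ ^ 2 ≤ b} := by
    ext D; simp [goodDraws]
  rw [h1]
  exact (MeasurableSet.iUnion fun i => measurableSet_le
    ((measurable_smoothGrad_runs P x₁ m hd hL hσ i).norm.pow_const 2) measurable_const).inter
    (MeasurableSet.iInter fun i => measurableSet_le (measurable_error P x₁ m hd hL hσ i)
      measurable_const)

/-- The runs are independent, so their failure probabilities multiply. The selection samples are
shared by all candidates but independent of them: with the runs fixed, Markov applies to each
candidate, and a union bound combines them. -/
theorem measure_compl_goodDraws_le (hd : 0 < d) (hL : 0 ≤ P.L₀) (hσ : 0 < m.σ) (hK : 0 < m.K)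
    (hT : 0 < m.T) {a b e : ℝ} (ha : 0 < a) (hb : 0 < b)
    (hrun : ∫⁻ D, ENNReal.ofReal (‖smoothGrad P.f m.σ (run P.G m.η x₁ D).1‖ ^ 2)
      ∂runLaw P m.σ m.S m.K ≤ ENNReal.ofReal e) :
    drawsLaw P m (goodDraws P x₁ m a b)ᶜ ≤
      ENNReal.ofReal (e / a) ^ m.runs + m.runs * ENNReal.ofReal (P.Q / m.T / b) := by
  have := isProbabilityMeasure_runLaw P hσ m.S hK
  have := isProbabilityMeasure_sampleLaw P hσ
  set ρ := Measure.pi fun _ : Fin m.runs => runLaw P m.σ m.S m.K with hρ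
  set τ := Measure.pi fun _ : Fin m.T => sampleLaw P m.σ with hτ
  have hlaw : drawsLaw P m = ρ.prod τ := rfl
  have hsm : Measurable fun D : RunDraws d p m.K m.S =>
      ‖smoothGrad P.f m.σ (run P.G m.η x₁ D).1‖ ^ 2 :=
    (((continuous_smoothGrad hd (P.lipschitzWith_f hL) hσ).measurable.comp
      (measurable_run P.measurable_G m.η m.K m.S x₁)).norm.pow_const 2)
  set B : Set (RunDraws d p m.K m.S) := {D | a < ‖smoothGrad P.f m.σ (run P.G m.η x₁ D).1‖ ^ 2}
  have hB : runLaw P m.σ m.S m.K B ≤ ENNReal.ofReal (e / a) :=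
    measure_lt_le_of_lintegral_le ha hrun hsm
  have h1 : ρ.prod τ ((Set.univ.pi fun _ => B) ×ˢ Set.univ) ≤ ENNReal.ofReal (e / a) ^ m.runs := by
    rw [Measure.prod_prod, measure_univ, mul_one, hρ, Measure.pi_pi, Finset.prod_const,
      Finset.card_univ, Fintype.card_fin]
    gcongr
  have h2 (i : Fin m.runs) : ρ.prod τ {D : Draws d p m |
      b < ‖(avgGrad P.G D.2 (run P.G m.η x₁ (D.1 i)).1).1 -
        smoothGrad P.f m.σ (run P.G m.η x₁ (D.1 i)).1‖ ^ 2} ≤ ENNReal.ofReal (P.Q / m.T / b) := by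
    have hmeas : MeasurableSet {D : Draws d p m |
      b < ‖(avgGrad P.G D.2 (run P.G m.η x₁ (D.1 i)).1).1 -
        smoothGrad P.f m.σ (run P.G m.η x₁ (D.1 i)).1‖ ^ 2} :=
      measurableSet_lt measurable_const (measurable_error P x₁ m hd hL hσ i)
    rw [Measure.prod_apply hmeas]
    calc _ ≤ ∫⁻ _, ENNReal.ofReal (P.Q / m.T / b) ∂ρ := by
          refine lintegral_mono fun D => ?_
          refine measure_lt_le_of_lintegral_le hb
            (lintegral_norm_avgGrad_sub_sq_le P hd hL hσ hT (run P.G m.η x₁ (D i)).1) ?_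
          exact (measurable_error P x₁ m hd hL hσ i).comp measurable_prodMk_left
      _ = _ := by rw [lintegral_const, measure_univ, mul_one]
  have hsub : (goodDraws P x₁ m a b)ᶜ ⊆ ((Set.univ.pi fun _ => B) ×ˢ Set.univ) ∪
      ⋃ i, {D : Draws d p m | b < ‖(avgGrad P.G D.2 (run P.G m.η x₁ (D.1 i)).1).1 -
        smoothGrad P.f m.σ (run P.G m.η x₁ (D.1 i)).1‖ ^ 2} := by
    intro D hD
    by_contra hcon
    rw [mem_union, not_or] at hcon
    refine hD ⟨?_, fun i => ?_⟩
    · by_contra hne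
      push Not at hne
      exact hcon.1 ⟨fun i _ => hne i, mem_univ _⟩
    · by_contra hne
      exact hcon.2 (mem_iUnion.2 ⟨i, not_le.1 hne⟩)
  rw [hlaw]
  refine (measure_mono hsub).trans ((measure_union_le _ _).trans (add_le_add h1 ?_))
  refine (measure_iUnion_fintype_le _ _).trans ((Finset.sum_le_sum fun i _ => h2 i).trans_eq ?_)
  simp

/-- A measurable event of probability at least `1 - γ` on which the draws are good. -/
theorem exists_event_of_compl_le {Ω Ω' : Type*} [MeasurableSpace Ω] [MeasurableSpace Ω']
    {μ : Measure Ω} [IsProbabilityMeasure μ] {ν : Measure Ω'} {D : Ω → Ω'} (hD : HasLaw D ν μ)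
    {s : Set Ω'} (hs : MeasurableSet s) {γ : ℝ} (h : ν sᶜ ≤ ENNReal.ofReal γ) (hγ : 0 ≤ γ) :
    ∃ A : Set Ω, MeasurableSet A ∧ 1 - γ ≤ μ.real A ∧ ∀ ω ∈ A, D ω ∈ s := by
  have := hD.isProbabilityMeasure_iff.1 ‹_›
  have hnull : NullMeasurableSet (D ⁻¹' s) μ := hD.aemeasurable.nullMeasurable hs
  -- `D` is only almost everywhere measurable, so the preimage is shrunk to a measurable set of the
  -- same probability.
  obtain ⟨A, hAs, hA, hAe⟩ := hnull.exists_measurable_subset_ae_eq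
  refine ⟨A, hA, ?_, fun ω hω => hAs hω⟩
  have h1 : μ.real A = ν.real s := by
    rw [measureReal_congr hAe, measureReal_def, measureReal_def, ← hD.map_eq,
      Measure.map_apply_of_aemeasurable hD.aemeasurable hs]
  have h2 : ν.real sᶜ ≤ γ := ENNReal.toReal_le_of_le_ofReal hγ h
  rw [probReal_compl_eq_one_sub hs] at h2
  linarith

end

section

variable {d p : ℕ}

/-! ### Estimates for the parameters -/

section

variable {c γ φ Q ε₂ : ℝ}

theorem exp_neg_numRuns_le (hc : 0 < c) (hγ : 0 < γ) :
    Real.exp (-(numRuns c γ : ℝ)) ≤ c * γ := by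
  have h1 : -Real.log (c * γ) ≤ numRuns c γ := Nat.le_ceil _
  calc Real.exp (-(numRuns c γ : ℝ)) ≤ Real.exp (Real.log (c * γ)) :=
        Real.exp_le_exp.2 (by linarith)
    _ = c * γ := Real.exp_log (by positivity)

theorem psi_pos (hc : c < 1) (hγ : 0 < γ) : 0 < psi c γ := by
  have : 0 < 1 - c := by linarith
  unfold psi; positivity

theorem numRuns_div_psi_le (hc : c < 1) (hγ : 0 < γ) :
    (numRuns c γ : ℝ) * (1 / psi c γ) ≤ (1 - c) * γ := by
  have h1 : 0 < 1 - c := by linarith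
  have h2 : (0 : ℝ) < (numRuns c γ : ℝ) + 1 := by positivity
  rw [psi, one_div_div, ← mul_div_assoc, div_le_iff₀ h2]
  have : 0 < (1 - c) * γ := by positivity
  nlinarith

theorem numSel_pos (hc : c < 1) (hγ : 0 < γ) (hφ : 1 < φ) (hQ : 0 < Q) (hε : 0 < ε₂) :
    0 < numSel c φ γ Q ε₂ := by
  have := psi_pos hc hγ
  exact Nat.ceil_pos.2 (by positivity)

theorem six_psi_div_numSel_le (hc : c < 1) (hγ : 0 < γ) (hφ : 1 < φ) (hQ : 0 < Q)
    (hε : 0 < ε₂) : 6 * psi c γ * (Q / numSel c φ γ Q ε₂) ≤ ε₂ ^ 2 / φ := by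
  have hψ := psi_pos hc hγ
  have hT : (0 : ℝ) < numSel c φ γ Q ε₂ := by exact_mod_cast numSel_pos hc hγ hφ hQ hε
  have h1 : 6 * φ * psi c γ * (Q / ε₂ ^ 2) ≤ numSel c φ γ Q ε₂ := Nat.le_ceil _
  rw [← mul_div_assoc, div_le_iff₀ (by positivity)] at h1
  rw [← mul_div_assoc, div_le_div_iff₀ hT (by positivity)]
  linarith

/-- The choice of `T` spends at most the fraction 1/φ of ε₂² on the selection error. What remains
for the runs is comparable to ε₂² uniformly in γ. -/
theorem le_eps₂'_sq (hc : c < 1) (hγ : 0 < γ) (hφ : 1 < φ) (hQ : 0 < Q) (hε : 0 < ε₂) :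
    (1 - 1 / φ) / (4 * Real.exp 1) * ε₂ ^ 2 ≤
      (ε₂ ^ 2 - 6 * psi c γ * (Q / numSel c φ γ Q ε₂)) / (4 * Real.exp 1) := by
  have h := six_psi_div_numSel_le hc hγ hφ hQ hε
  rw [div_mul_eq_mul_div]
  gcongr
  calc (1 - 1 / φ) * ε₂ ^ 2 = ε₂ ^ 2 - ε₂ ^ 2 / φ := by ring
    _ ≤ _ := by linarith

theorem one_sub_inv_pos (hφ : 1 < φ) : 0 < (1 - 1 / φ) / (4 * Real.exp 1) := by
  have : 1 / φ < 1 := by rw [div_lt_one (by linarith)]; exact hφ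
  have : 0 < 1 - 1 / φ := by linarith
  positivity

theorem eps₂'_sq (hc : c < 1) (hγ : 0 < γ) (hφ : 1 < φ) (hQ : 0 < Q) (hε : 0 < ε₂) :
    eps₂' c φ γ Q ε₂ ^ 2 =
      (ε₂ ^ 2 - 6 * psi c γ * (Q / numSel c φ γ Q ε₂)) / (4 * Real.exp 1) := by
  refine Real.sq_sqrt (le_trans ?_ (le_eps₂'_sq hc hγ hφ hQ hε))
  have := one_sub_inv_pos hφ
  positivity

theorem eps₂'_pos (hc : c < 1) (hγ : 0 < γ) (hφ : 1 < φ) (hQ : 0 < Q) (hε : 0 < ε₂) :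
    0 < eps₂' c φ γ Q ε₂ := by
  refine Real.sqrt_pos.2 (lt_of_lt_of_le ?_ (le_eps₂'_sq hc hγ hφ hQ hε))
  have := one_sub_inv_pos hφ
  positivity

theorem four_exp_mul_eps₂'_sq (hc : c < 1) (hγ : 0 < γ) (hφ : 1 < φ) (hQ : 0 < Q)
    (hε : 0 < ε₂) : 4 * (Real.exp 1 * eps₂' c φ γ Q ε₂ ^ 2) +
      6 * (psi c γ * (Q / numSel c φ γ Q ε₂)) = ε₂ ^ 2 := by
  rw [eps₂'_sq hc hγ hφ hQ hε]
  have := Real.exp_pos 1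
  field_simp
  ring

end

section

variable {L₀ Q Δ ε₁ e : ℝ}

/-- The purpose of the first entry of the maximum: it makes the argument of the logarithm in β
positive, and forces the accuracy to be coarse when `K = 1`. -/
theorem lt_bigK_mul (he : 0 < e) :
    2 * (L₀ * Δ + Q + √d * L₀ ^ 2) < bigK d L₀ Q Δ ε₁ e * e ^ 2 := by
  have h1 : 2 / e ^ 2 * (L₀ * Δ + Q + √d * L₀ ^ 2) < bigK d L₀ Q Δ ε₁ e := by
    have h2 := Nat.lt_floor_add_one (2 / e ^ 2 * (L₀ * Δ + Q + √d * L₀ ^ 2) + 1)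
    have h3 : ⌊2 / e ^ 2 * (L₀ * Δ + Q + √d * L₀ ^ 2) + 1⌋₊ ≤ bigK d L₀ Q Δ ε₁ e :=
      le_max_left _ _
    have h4 : (⌊2 / e ^ 2 * (L₀ * Δ + Q + √d * L₀ ^ 2) + 1⌋₊ : ℝ) ≤ bigK d L₀ Q Δ ε₁ e := by
      exact_mod_cast h3
    linarith
  rw [div_mul_eq_mul_div, div_lt_iff₀ (by positivity)] at h1
  exact h1

/-- The purpose of the second entry of the maximum: it makes the radius σ at most ε₁. -/
theorem le_bigK_mul (he : 0 < e) :
    2 * √d * ((L₀ * Δ + Q) / ε₁ + L₀ ^ 2) ≤ bigK d L₀ Q Δ ε₁ e * e ^ 2 := by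
  have h1 : 2 * √d / e ^ 2 * ((L₀ * Δ + Q) / ε₁ + L₀ ^ 2) ≤ bigK d L₀ Q Δ ε₁ e := by
    refine (Nat.le_ceil _).trans ?_
    exact_mod_cast le_max_right _ _
  rw [div_mul_eq_mul_div, div_le_iff₀ (by positivity)] at h1
  exact h1

theorem bigK_pos (he : 0 < e) (hL : 0 < L₀) (hQ : 0 < Q) (hΔ : 0 ≤ Δ) :
    0 < bigK d L₀ Q Δ ε₁ e := by
  have h1 := lt_bigK_mul (d := d) (L₀ := L₀) (Q := Q) (Δ := Δ) (ε₁ := ε₁) he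
  have h2 : 0 ≤ 2 * (L₀ * Δ + Q + √d * L₀ ^ 2) := by positivity
  have h3 : (bigK d L₀ Q Δ ε₁ e : ℝ) ≠ 0 := fun h => by rw [h] at h1; linarith
  exact Nat.pos_of_ne_zero (by exact_mod_cast h3)

/-- The scale `K^(-β)`. -/
theorem rpow_neg_beta (he : 0 < e) (hL : 0 < L₀) (hQ : 0 < Q) (hΔ : 0 ≤ Δ)
    (hK : 1 < bigK d L₀ Q Δ ε₁ e) :
    (bigK d L₀ Q Δ ε₁ e : ℝ) ^ (-beta d L₀ Q Δ ε₁ e) =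
      2 * (L₀ * Δ + Q) / (bigK d L₀ Q Δ ε₁ e * e ^ 2 - 2 * √d * L₀ ^ 2) := by
  have h1 := lt_bigK_mul (d := d) (L₀ := L₀) (Q := Q) (Δ := Δ) (ε₁ := ε₁) he
  have hb : 0 < 2 * (L₀ * Δ + Q) := by positivity
  have ha : 0 < bigK d L₀ Q Δ ε₁ e * e ^ 2 - 2 * √d * L₀ ^ 2 := by linarith
  have hK' : (1 : ℝ) < bigK d L₀ Q Δ ε₁ e := by exact_mod_cast hK
  have hlog := Real.log_pos hK'
  rw [Real.rpow_def_of_pos (by linarith), beta, mul_neg, mul_div_cancel₀ _ hlog.ne', neg_sub,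
    Real.exp_sub, Real.exp_log hb, Real.exp_log ha]

theorem scale_le (hd : 0 < d) (he : 0 < e) (hL : 0 < L₀) (hQ : 0 < Q) (hΔ : 0 ≤ Δ) (hε : 0 < ε₁)
    (hK : 1 < bigK d L₀ Q Δ ε₁ e) :
    √d * (bigK d L₀ Q Δ ε₁ e : ℝ) ^ (-beta d L₀ Q Δ ε₁ e) ≤ ε₁ := by
  have h1 := lt_bigK_mul (d := d) (L₀ := L₀) (Q := Q) (Δ := Δ) (ε₁ := ε₁) he
  have h2 := le_bigK_mul (d := d) (L₀ := L₀) (Q := Q) (Δ := Δ) (ε₁ := ε₁) he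
  have hb : 0 < 2 * (L₀ * Δ + Q) := by positivity
  have ha : 0 < bigK d L₀ Q Δ ε₁ e * e ^ 2 - 2 * √d * L₀ ^ 2 := by linarith
  rw [rpow_neg_beta he hL hQ hΔ hK, ← mul_div_assoc, div_le_iff₀ ha]
  have h3 : 2 * √d * ((L₀ * Δ + Q) / ε₁) ≤ bigK d L₀ Q Δ ε₁ e * e ^ 2 - 2 * √d * L₀ ^ 2 := by
    linarith
  calc √d * (2 * (L₀ * Δ + Q)) = ε₁ * (2 * √d * ((L₀ * Δ + Q) / ε₁)) := by field_simp
    _ ≤ _ := by gcongr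

/-- β is chosen so that 2(L₀Δ + Q)/(K t) + 2√d L₀²/K = e² for t = K^(-β). The bound needs only one Q
instead of two, which leaves slack. -/
theorem run_bound_le (he : 0 < e) (hL : 0 < L₀) (hQ : 0 < Q) (hΔ : 0 ≤ Δ)
    (hK : 1 < bigK d L₀ Q Δ ε₁ e) {t : ℝ}
    (ht : t = (bigK d L₀ Q Δ ε₁ e : ℝ) ^ (-beta d L₀ Q Δ ε₁ e)) {S : ℝ}
    (hS : bigK d L₀ Q Δ ε₁ e * t ≤ S) :
    2 * (Δ + L₀ * (√d * t)) / (bigK d L₀ Q Δ ε₁ e * (1 / L₀ * t)) + Q / S ≤ e ^ 2 := by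
  have h1 := lt_bigK_mul (d := d) (L₀ := L₀) (Q := Q) (Δ := Δ) (ε₁ := ε₁) he
  have hb : 0 < 2 * (L₀ * Δ + Q) := by positivity
  rw [rpow_neg_beta he hL hQ hΔ hK] at ht
  set K := (bigK d L₀ Q Δ ε₁ e : ℝ) with hKdef
  have hK0 : 0 < K := by
    have : (1 : ℝ) < K := by rw [hKdef]; exact_mod_cast hK
    linarith
  set a := K * e ^ 2 - 2 * √d * L₀ ^ 2 with hadef
  have ha : 0 < a := by linarith
  have ht0 : 0 < t := by rw [ht]; positivity
  have h2 : Q / S ≤ Q / (K * t) := by gcongr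
  have h3 : 2 * (L₀ * Δ + Q) = a * t := by rw [ht]; field_simp
  calc _ ≤ 2 * (Δ + L₀ * (√d * t)) / (K * (1 / L₀ * t)) + Q / (K * t) := by gcongr
    _ = (2 * (L₀ * Δ + Q) - Q + 2 * √d * L₀ ^ 2 * t) / (K * t) := by field_simp; ring
    _ ≤ (a * t + 2 * √d * L₀ ^ 2 * t) / (K * t) := by rw [h3]; gcongr; linarith
    _ = e ^ 2 := by rw [hadef]; field_simp; ring

end

end

section

variable {d p : ℕ}

/-! ### Stationarity with high probability -/

theorem exists_event_isStationary {c φ γ ε₁ ε₂ : ℝ} (hc₀ : 0 < c) (hc₁ : c < 1) (hφ : 1 < φ)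
    (hd : 0 < d) (P : Problem d p) (hL : 0 < P.L₀) {x₁ xmin : Vec d}
    (hmin : ∀ x, P.f xmin ≤ P.f x) (hγ₀ : 0 < γ) (hε₁ : 0 < ε₁) (hε₂ : 0 < ε₂) {m : Settings}
    (hm : m = settings d c φ P.L₀ P.Q (P.f x₁ - P.f xmin) γ ε₁ ε₂)
    {Ω : Type*} [MeasurableSpace Ω] (μ : Measure Ω) [IsProbabilityMeasure μ]
    {D : Ω → Draws d p m} (hD : HasLaw D (drawsLaw P m) μ) {xstar : Ω → Vec d}
    (hx : ∀ ω, xstar ω ∈ selected P.G x₁ (D ω)) :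
    ∃ A : Set Ω, MeasurableSet A ∧ 1 - γ ≤ μ.real A ∧
      ∀ ω ∈ A, IsStationary P.f ε₁ ε₂ (xstar ω) := by
  have hlip := P.lipschitzWith_f hL.le
  have hQ : 0 < P.Q := lt_of_lt_of_le (by positivity) P.L₀_sq_le_Q
  have hΔ : 0 ≤ P.f x₁ - P.f xmin := sub_nonneg.2 (hmin x₁)
  set e := eps₂' c φ γ P.Q ε₂ with he
  have he0 : 0 < e := eps₂'_pos hc₁ hγ₀ hφ hQ hε₂
  have hψ := psi_pos hc₁ hγ₀
  have hT0 := numSel_pos hc₁ hγ₀ hφ hQ hε₂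
  have hT0' : (0 : ℝ) < numSel c φ γ P.Q ε₂ := by exact_mod_cast hT0
  have hfour := four_exp_mul_eps₂'_sq hc₁ hγ₀ hφ hQ hε₂
  rw [← he] at hfour
  have hexp : 1 ≤ Real.exp 1 := Real.one_le_exp zero_le_one
  set Δ := P.f x₁ - P.f xmin with hΔdef
  have hKpos : 0 < bigK d P.L₀ P.Q Δ ε₁ e := bigK_pos he0 hL hQ hΔ
  rcases (Nat.succ_le_of_lt hKpos).eq_or_lt with hK | hK
  -- If `K = 1`, then L₀² ≤ Q < e² < ε₂², so every point is stationary: smoothing with radius ε₁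
  -- yields a gradient of norm at most L₀.
  · refine ⟨Set.univ, MeasurableSet.univ, by simpa using hγ₀.le, fun ω _ =>
      isStationary_of_norm_smoothGrad_le hlip hε₁ le_rfl ?_⟩
    refine (norm_smoothGrad_le hlip hε₁ _).trans ?_
    rw [Real.coe_toNNReal _ hL.le]
    have h1 := lt_bigK_mul (d := d) (L₀ := P.L₀) (Q := P.Q) (Δ := Δ) (ε₁ := ε₁) he0
    rw [← hK, Nat.succ_eq_add_one, zero_add, Nat.cast_one, one_mul] at h1
    have h2 := P.L₀_sq_le_Q
    have h3 : 0 ≤ P.L₀ * Δ := by positivity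
    have h4 : 0 ≤ √d * P.L₀ ^ 2 := by positivity
    have h5 : 0 ≤ psi c γ * (P.Q / numSel c φ γ P.Q ε₂) := by positivity
    refine (sq_le_sq₀ hL.le hε₂.le).1 ?_
    nlinarith [sq_nonneg e]
  replace hK : 1 < bigK d P.L₀ P.Q Δ ε₁ e := hK
  set t : ℝ := (bigK d P.L₀ P.Q Δ ε₁ e : ℝ) ^ (-beta d P.L₀ P.Q Δ ε₁ e) with ht
  have hKr : (0 : ℝ) < bigK d P.L₀ P.Q Δ ε₁ e := by exact_mod_cast hKpos
  have ht0 : 0 < t := Real.rpow_pos_of_pos hKr _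
  have hmσ : m.σ = √d * t := by rw [hm]; rfl
  have hmη : m.η = 1 / P.L₀ * t := by rw [hm]; rfl
  have hmK : m.K = bigK d P.L₀ P.Q Δ ε₁ e := by rw [hm]; rfl
  have hmT : m.T = numSel c φ γ P.Q ε₂ := by rw [hm]; rfl
  have hmR : m.runs = numRuns c γ := by rw [hm]; rfl
  have hmS : m.S = ⌈(bigK d P.L₀ P.Q Δ ε₁ e : ℝ) ^ (1 - beta d P.L₀ P.Q Δ ε₁ e)⌉₊ := by
    rw [hm]; rfl
  have hd0 : (0 : ℝ) < √d := by positivity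
  have hσ : 0 < m.σ := by rw [hmσ]; positivity
  have hση : m.η = m.σ / (√d * P.L₀) := by rw [hmσ, hmη]; field_simp
  have hKt : bigK d P.L₀ P.Q Δ ε₁ e * t ≤ m.S := by
    rw [hmS]
    refine le_trans (le_of_eq ?_) (Nat.le_ceil _)
    rw [ht, sub_eq_add_neg, Real.rpow_add hKr, Real.rpow_one]
  have hS : 0 < m.S := by
    have h1 : (0 : ℝ) < m.S := lt_of_lt_of_le (by positivity) hKt
    exact_mod_cast h1
  have hrun := lintegral_run_le P hd hL hσ hση hmin hS x₁ (K := m.K) (hmK ▸ hKpos)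
  have hbound := run_bound_le he0 hL hQ hΔ hK ht hKt
  rw [hmσ, hmη, hmK] at hrun
  replace hrun := hrun.trans (ENNReal.ofReal_le_ofReal hbound)
  rw [← hmσ, ← hmη, ← hmK] at hrun
  have ha : 0 < Real.exp 1 * e ^ 2 := by positivity
  have hb : 0 < psi c γ * (P.Q / m.T) := by rw [hmT]; positivity
  have hcompl := measure_compl_goodDraws_le P x₁ m hd hL.le hσ (hmK ▸ hKpos) (hmT ▸ hT0) ha hb hrun
  have hsum : ENNReal.ofReal (e ^ 2 / (Real.exp 1 * e ^ 2)) ^ m.runs +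
      m.runs * ENNReal.ofReal (P.Q / m.T / (psi c γ * (P.Q / m.T))) ≤ ENNReal.ofReal γ := by
    have h1 : e ^ 2 / (Real.exp 1 * e ^ 2) = Real.exp (-1) := by
      rw [Real.exp_neg]; field_simp
    have h2 : P.Q / m.T / (psi c γ * (P.Q / m.T)) = 1 / psi c γ := by
      have : (0 : ℝ) < m.T := by rw [hmT]; exact hT0'
      field_simp
    rw [h1, h2, ← ENNReal.ofReal_pow (Real.exp_pos _).le, ← ENNReal.ofReal_natCast,
      ← ENNReal.ofReal_mul (by positivity), ← ENNReal.ofReal_add (by positivity) (by positivity)]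
    refine ENNReal.ofReal_le_ofReal ?_
    have h3 := exp_neg_numRuns_le hc₀ hγ₀
    have h4 := numRuns_div_psi_le hc₁ hγ₀
    rw [← Real.exp_nat_mul, mul_neg, mul_one, hmR]
    linarith
  obtain ⟨A, hA, hAγ, hAg⟩ := exists_event_of_compl_le hD
    (measurableSet_goodDraws P x₁ m hd hL.le hσ _ _) (hcompl.trans hsum) hγ₀.le
  refine ⟨A, hA, hAγ, fun ω hω => isStationary_of_norm_smoothGrad_le hlip hσ ?_ ?_⟩
  · rw [hmσ]
    exact scale_le hd he0 hL hQ hΔ hε₁ hK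
  · have h1 := norm_smoothGrad_sq_le_of_mem_goodDraws P (hAg ω hω) (hx ω)
    rw [hmT, hfour] at h1
    exact (sq_le_sq₀ (norm_nonneg _) hε₂.le).1 h1

/-! ### The number of gradient calls -/

theorem avgGrad_snd (G : Vec d → Vec p → Vec d) {n : ℕ} (s : Fin n → Vec d × Vec p) (x : Vec d) :
    (avgGrad G s x).2 = n := by
  simp [avgGrad, gradCall]

theorem iterate_snd (G : Vec d → Vec p → Vec d) (η : ℝ) {S : ℕ} (x₁ : Vec d) (n : ℕ)
    (s : Fin n → Fin S → Vec d × Vec p) : (iterate G η x₁ n s).2 = n * S := by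
  induction n with
  | zero => simp [iterate]
  | succ n ih => simp only [iterate, ih, avgGrad_snd]; ring

theorem totalCalls_le (G : Vec d → Vec p → Vec d) (x₁ : Vec d) {m : Settings}
    (D : Draws d p m) : totalCalls G x₁ D ≤ m.runs * ((m.K - 1) * m.S) + m.runs * m.T := by
  simp only [totalCalls, avgGrad_snd, Finset.sum_const, Finset.card_univ, Fintype.card_fin,
    smul_eq_mul]
  refine Nat.add_le_add_right ?_ _
  refine (Finset.sum_le_sum (g := fun _ => (m.K - 1) * m.S) fun i _ => ?_).trans_eq (by simp)
  rw [run, iterate_snd]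
  exact Nat.mul_le_mul_right _ (Nat.le_sub_one_of_lt (D.1 i).1.isLt)

/-- Only the number of iterations grows with 1/ε₁. The batch size is K^(1-β) = K t up to rounding,
and there the factor `K` nearly cancels. A run has at most `K - 1` iterations, so for `K = 1` there
is nothing to bound. -/
theorem bigK_sub_one_mul_batch_le {L₀ Q Δ ε₁ e : ℝ} (he : 0 < e) (hL : 0 < L₀)
    (hQ : 0 < Q) (hΔ : 0 ≤ Δ) (hε : 0 < ε₁) (hε' : ε₁ ≤ 1) {a : ℝ}
    (ha : a = 2 * (L₀ * Δ + Q) + 2 * √d * L₀ ^ 2) :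
    ((bigK d L₀ Q Δ ε₁ e - 1 : ℕ) : ℝ) *
        ⌈(bigK d L₀ Q Δ ε₁ e : ℝ) ^ (1 - beta d L₀ Q Δ ε₁ e)⌉₊ ≤
      ((1 + √d) * a / (e ^ 2 * ε₁) + 1) * (a / e ^ 2 + 1) := by
  have hd0 : (0 : ℝ) ≤ √d := Real.sqrt_nonneg _
  have ha0 : 0 < a := by rw [ha]; positivity
  have hKpos := bigK_pos (d := d) (ε₁ := ε₁) he hL hQ hΔ
  rcases (Nat.succ_le_of_lt hKpos).eq_or_lt with hK | hK
  · rw [← hK]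
    simp only [Nat.succ_eq_add_one, zero_add, Nat.sub_self, Nat.cast_zero, zero_mul]
    positivity
  replace hK : 1 < bigK d L₀ Q Δ ε₁ e := hK
  have h1 := lt_bigK_mul (d := d) (L₀ := L₀) (Q := Q) (Δ := Δ) (ε₁ := ε₁) he
  have hKr : (0 : ℝ) < bigK d L₀ Q Δ ε₁ e := by exact_mod_cast hKpos
  have hbatch : (⌈(bigK d L₀ Q Δ ε₁ e : ℝ) ^ (1 - beta d L₀ Q Δ ε₁ e)⌉₊ : ℝ) ≤ a / e ^ 2 + 1 := by
    refine (Nat.ceil_lt_add_one (by positivity)).le.trans ?_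
    gcongr
    rw [sub_eq_add_neg, Real.rpow_add hKr, Real.rpow_one, rpow_neg_beta he hL hQ hΔ hK]
    set K := (bigK d L₀ Q Δ ε₁ e : ℝ)
    have hpos : 0 < K * e ^ 2 - 2 * √d * L₀ ^ 2 := by
      have : 0 < 2 * (L₀ * Δ + Q) := by positivity
      linarith
    rw [← mul_div_assoc, div_le_div_iff₀ hpos (by positivity), ha]
    -- This product is the difference of the two sides after clearing denominators.
    have h2 : 0 ≤ 2 * √d * L₀ ^ 2 * (K * e ^ 2 - 2 * (L₀ * Δ + Q + √d * L₀ ^ 2)) :=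
      mul_nonneg (by positivity) (by linarith)
    linarith
  have hKle : ((bigK d L₀ Q Δ ε₁ e - 1 : ℕ) : ℝ) ≤ (1 + √d) * a / (e ^ 2 * ε₁) + 1 := by
    have h2 : ((bigK d L₀ Q Δ ε₁ e - 1 : ℕ) : ℝ) ≤ bigK d L₀ Q Δ ε₁ e := by
      exact_mod_cast Nat.sub_le _ _
    refine h2.trans ?_
    rw [bigK, Nat.cast_max]
    have hLΔ : 0 ≤ L₀ * Δ := by positivity
    have hsq : 0 ≤ √d * L₀ ^ 2 := by positivity
    refine max_le ?_ ?_
    · refine (Nat.floor_le (by positivity)).trans ?_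
      gcongr
      calc 2 / e ^ 2 * (L₀ * Δ + Q + √d * L₀ ^ 2) = a / e ^ 2 := by rw [ha]; ring
        _ ≤ (1 + √d) * a / (e ^ 2 * ε₁) := by
            refine div_le_div₀ (by positivity) ?_ (by positivity) ?_
            · nlinarith
            · exact mul_le_of_le_one_right (by positivity) hε'
    · refine (Nat.ceil_lt_add_one (by positivity)).le.trans ?_
      gcongr
      calc 2 * √d / e ^ 2 * ((L₀ * Δ + Q) / ε₁ + L₀ ^ 2)
          = (√d * (2 * (L₀ * Δ + Q)) + 2 * √d * L₀ ^ 2 * ε₁) / (e ^ 2 * ε₁) := by field_simp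
        _ ≤ (1 + √d) * a / (e ^ 2 * ε₁) := by
            gcongr
            have h3 : 2 * √d * L₀ ^ 2 * ε₁ ≤ 2 * √d * L₀ ^ 2 :=
              mul_le_of_le_one_right (by positivity) hε'
            have h4 : 0 ≤ √d * (2 * √d * L₀ ^ 2) := by positivity
            rw [ha]
            nlinarith
  exact mul_le_mul hKle hbatch (Nat.cast_nonneg _) (by positivity)

/-- Since log g ≥ log 2 > 0, additive constants are absorbed into multiples of log g. -/
theorem numRuns_add_one_le {c γ g : ℝ} (hc₀ : 0 < c) (hc₁ : c < 1) (hγ₀ : 0 < γ) (hγ₁ : γ < 1)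
    (hg : 2 ≤ g) (hgγ : 1 / γ ≤ g) :
    (numRuns c γ : ℝ) + 1 ≤ ((2 - Real.log c) / Real.log 2 + 1) * Real.log g := by
  have h0 : 0 ≤ -Real.log (c * γ) :=
    neg_nonneg.2 (Real.log_nonpos (by positivity) (by nlinarith))
  have h1 : (numRuns c γ : ℝ) < -Real.log (c * γ) + 1 := Nat.ceil_lt_add_one h0
  rw [Real.log_mul hc₀.ne' hγ₀.ne'] at h1
  have h2 : -Real.log γ ≤ Real.log g := by
    rw [← Real.log_inv, ← one_div]
    exact Real.log_le_log (by positivity) hgγ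
  have hl2 : 0 < Real.log 2 := Real.log_pos (by norm_num)
  have h3 : Real.log 2 ≤ Real.log g := Real.log_le_log (by norm_num) hg
  have h4 : 0 ≤ 2 - Real.log c := by linarith [Real.log_nonpos hc₀.le hc₁.le]
  have h5 : 2 - Real.log c ≤ (2 - Real.log c) / Real.log 2 * Real.log g := by
    rw [div_mul_eq_mul_div, le_div_iff₀ hl2]
    gcongr
  linarith

theorem numSel_le {c φ γ Q ε₂ : ℝ} (hc₁ : c < 1) (hφ : 1 < φ) (hγ₀ : 0 < γ) (hγ₁ : γ < 1)
    (hQ : 0 < Q) (hε₂ : 0 < ε₂) (hε₂' : ε₂ ≤ 1) :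
    (numSel c φ γ Q ε₂ : ℝ) ≤
      (6 * φ * Q / (1 - c) + 1) * ((numRuns c γ : ℝ) + 1) * (1 / (γ * ε₂ ^ 2)) := by
  have hψ := psi_pos hc₁ hγ₀
  have hc : 0 < 1 - c := by linarith
  refine (Nat.ceil_lt_add_one (by positivity)).le.trans ?_
  have h1 : (1 : ℝ) ≤ 1 / (γ * ε₂ ^ 2) := by
    rw [le_div_iff₀ (by positivity), one_mul]
    exact mul_le_one₀ hγ₁.le (by positivity) (pow_le_one₀ hε₂.le hε₂')
  have h2 : (1 : ℝ) ≤ (numRuns c γ : ℝ) + 1 := by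
    linarith [(Nat.cast_nonneg (numRuns c γ) : (0 : ℝ) ≤ _)]
  have h3 : 6 * φ * psi c γ * (Q / ε₂ ^ 2) =
      6 * φ * Q / (1 - c) * ((numRuns c γ : ℝ) + 1) * (1 / (γ * ε₂ ^ 2)) := by
    rw [psi]; field_simp
  rw [h3]
  nlinarith [mul_le_mul h2 h1 zero_le_one (by linarith)]

theorem calls_arith {R X Y C₁ C₂ : ℝ} (hR : 0 ≤ R) (hX : 0 ≤ X) (hY : 0 ≤ Y) (hC₁ : 0 ≤ C₁)
    (hC₂ : 0 ≤ C₂) :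
    R * (C₁ * X) + R * (C₂ * (R + 1) * Y) ≤ (C₁ + C₂) * (X + Y) * (R + 1) ^ 2 := by
  have h : (C₁ + C₂) * (X + Y) * (R + 1) ^ 2 - (R * (C₁ * X) + R * (C₂ * (R + 1) * Y)) =
      C₁ * X * (R ^ 2 + R + 1) + C₁ * Y * (R + 1) ^ 2 + C₂ * X * (R + 1) ^ 2 +
        C₂ * Y * (R + 1) := by ring
  refine sub_nonneg.1 ?_
  rw [h]
  positivity

/-- The signs of Q and Δ are assumed only after `M` is chosen: in the theorem `M` is fixed from L₀,
Q, Δ before any problem that realizes them is given. -/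
theorem exists_totalCalls_le {c φ : ℝ} (hc₀ : 0 < c) (hc₁ : c < 1) (hφ : 1 < φ) (d : ℕ)
    (L₀ Q Δ : ℝ) (hL : 0 < L₀) :
    ∃ M : ℝ, 0 < Q → 0 ≤ Δ → ∀ (p : ℕ) (G : Vec d → Vec p → Vec d) (x₁ : Vec d) (γ ε₁ ε₂ : ℝ),
      0 < γ → γ < 1 → 0 < ε₁ → ε₁ ≤ 1 → 0 < ε₂ → ε₂ ≤ 1 →
      ∀ D : Draws d p (settings d c φ L₀ Q Δ γ ε₁ ε₂),
        (totalCalls G x₁ D : ℝ) ≤ M * rate γ ε₁ ε₂ * Real.log (rate γ ε₁ ε₂) ^ 2 := by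
  set a := 2 * (L₀ * Δ + Q) + 2 * √d * L₀ ^ 2 with ha
  set κ := (1 - 1 / φ) / (4 * Real.exp 1) with hκ
  have hκ0 : 0 < κ := one_sub_inv_pos hφ
  set C₁ := ((1 + √d) * a / κ + 1) * (a / κ + 1) with hC₁
  set C₂ := 6 * φ * Q / (1 - c) + 1 with hC₂
  set C₃ := (2 - Real.log c) / Real.log 2 + 1 with hC₃
  refine ⟨(C₁ + C₂) * C₃ ^ 2, fun hQ hΔ p G x₁ γ ε₁ ε₂ hγ₀ hγ₁ hε₁ hε₁' hε₂ hε₂' D => ?_⟩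
  have ha0 : 0 < a := by rw [ha]; positivity
  have hc : 0 < 1 - c := by linarith
  have hC₁0 : 0 < C₁ := by rw [hC₁]; positivity
  have hC₂0 : 0 < C₂ := by rw [hC₂]; positivity
  set e := eps₂' c φ γ Q ε₂ with he
  have he0 : 0 < e := eps₂'_pos hc₁ hγ₀ hφ hQ hε₂
  have heκ : κ * ε₂ ^ 2 ≤ e ^ 2 := by
    rw [he, eps₂'_sq hc₁ hγ₀ hφ hQ hε₂]
    exact le_eps₂'_sq hc₁ hγ₀ hφ hQ hε₂
  have hε₂sq : ε₂ ^ 2 ≤ 1 := pow_le_one₀ hε₂.le hε₂'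
  set X := 1 / (ε₁ * ε₂ ^ 4) with hX
  set Y := 1 / (γ * ε₂ ^ 2) with hY
  have hX1 : 1 ≤ X := by
    rw [hX, le_div_iff₀ (by positivity), one_mul]
    exact mul_le_one₀ hε₁' (by positivity) (pow_le_one₀ hε₂.le hε₂')
  have hYγ : 1 / γ ≤ Y := by
    rw [hY]
    exact one_div_le_one_div_of_le (by positivity) (mul_le_of_le_one_right hγ₀.le hε₂sq)
  have hY1 : 1 ≤ Y := le_trans (by rw [le_div_iff₀ hγ₀, one_mul]; exact hγ₁.le) hYγ
  have hrate : rate γ ε₁ ε₂ = X + Y := rfl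
  rw [hrate]
  have hR := numRuns_add_one_le (g := X + Y) hc₀ hc₁ hγ₀ hγ₁ (by linarith) (by linarith)
  rw [← hC₃] at hR
  have hKS : ((bigK d L₀ Q Δ ε₁ e - 1 : ℕ) : ℝ) *
      ⌈(bigK d L₀ Q Δ ε₁ e : ℝ) ^ (1 - beta d L₀ Q Δ ε₁ e)⌉₊ ≤ C₁ * X := by
    refine (bigK_sub_one_mul_batch_le he0 hL hQ hΔ hε₁ hε₁' ha).trans ?_
    have h1 : (1 + √d) * a / (e ^ 2 * ε₁) + 1 ≤
        ((1 + √d) * a / κ + 1) * (1 / (ε₁ * ε₂ ^ 2)) := by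
      have h2 : (1 : ℝ) ≤ 1 / (ε₁ * ε₂ ^ 2) := by
        rw [le_div_iff₀ (by positivity), one_mul]
        exact mul_le_one₀ hε₁' (by positivity) hε₂sq
      have h3 : (1 + √d) * a / (e ^ 2 * ε₁) ≤ (1 + √d) * a / κ * (1 / (ε₁ * ε₂ ^ 2)) := by
        calc (1 + √d) * a / (e ^ 2 * ε₁) ≤ (1 + √d) * a / (κ * ε₂ ^ 2 * ε₁) := by gcongr
          _ = _ := by field_simp
      linarith
    have h4 : a / e ^ 2 + 1 ≤ (a / κ + 1) * (1 / ε₂ ^ 2) := by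
      have h2 : (1 : ℝ) ≤ 1 / ε₂ ^ 2 := by
        rwa [le_div_iff₀ (by positivity), one_mul]
      have h3 : a / e ^ 2 ≤ a / κ * (1 / ε₂ ^ 2) := by
        calc a / e ^ 2 ≤ a / (κ * ε₂ ^ 2) := by gcongr
          _ = _ := by field_simp
      linarith
    refine (mul_le_mul h1 h4 (by positivity) (by positivity)).trans_eq ?_
    rw [hC₁, hX]
    field_simp
  have hT := numSel_le hc₁ hφ hγ₀ hγ₁ hQ hε₂ hε₂'
  rw [← hC₂, ← hY] at hT
  have hcalls : (totalCalls G x₁ D : ℝ) ≤ (numRuns c γ : ℝ) *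
      (((bigK d L₀ Q Δ ε₁ e - 1 : ℕ) : ℝ) *
        ⌈(bigK d L₀ Q Δ ε₁ e : ℝ) ^ (1 - beta d L₀ Q Δ ε₁ e)⌉₊) +
      numRuns c γ * numSel c φ γ Q ε₂ := by
    exact_mod_cast totalCalls_le G x₁ D
  set R : ℝ := (numRuns c γ : ℝ) with hRdef
  have hR0 : 0 ≤ R := Nat.cast_nonneg _
  refine hcalls.trans ((add_le_add (mul_le_mul_of_nonneg_left hKS hR0)
    (mul_le_mul_of_nonneg_left hT hR0)).trans ?_)
  refine (calls_arith hR0 (by linarith) (by linarith) hC₁0.le hC₂0.le).trans ?_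
  calc (C₁ + C₂) * (X + Y) * (R + 1) ^ 2
      ≤ (C₁ + C₂) * (X + Y) * (C₃ * Real.log (X + Y)) ^ 2 := by gcongr
    _ = (C₁ + C₂) * C₃ ^ 2 * (X + Y) * Real.log (X + Y) ^ 2 := by ring

end

end PISGD

theorem corollary4 (c φ : ℝ) (hc₀ : 0 < c) (hc₁ : c < 1) (hφ : 1 < φ) (d : ℕ) (hd : 0 < d) :
    -- every choice of the selected candidate is stationary with probability at least `1 - γ`
    (∀ (p : ℕ) (P : PISGD.Problem d p), 0 < P.L₀ →
      ∀ x₁ xmin : PISGD.Vec d, (∀ x, P.f xmin ≤ P.f x) →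
      ∀ γ ε₁ ε₂ : ℝ, 0 < γ → γ < 1 → 0 < ε₁ → 0 < ε₂ →
      ∀ m : PISGD.Settings,
        m = PISGD.settings d c φ P.L₀ P.Q (P.f x₁ - P.f xmin) γ ε₁ ε₂ →
      ∀ (Ω : Type*) [MeasurableSpace Ω] (μ : MeasureTheory.Measure Ω)
        [MeasureTheory.IsProbabilityMeasure μ] (D : Ω → PISGD.Draws d p m),
        ProbabilityTheory.HasLaw D (PISGD.drawsLaw P m) μ →
      ∀ xstar : Ω → PISGD.Vec d, (∀ ω, xstar ω ∈ PISGD.selected P.G x₁ (D ω)) →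
        ∃ A : Set Ω, MeasurableSet A ∧ 1 - γ ≤ μ.real A ∧
          ∀ ω ∈ A, PISGD.IsStationary P.f ε₁ ε₂ (xstar ω)) ∧
    -- the number of gradient calls, whatever the draws are, is `Õ(1/(ε₁ε₂⁴) + 1/(γε₂²))`, with
    -- constants that depend on `d`, `c`, `φ`, `L₀`, `Q` and `Δ` only
    (∀ L₀ Q Δ : ℝ, 0 < L₀ → ∃ (k : ℕ) (M : ℝ),
      ∀ (p : ℕ) (P : PISGD.Problem d p), P.L₀ = L₀ → P.Q = Q →
      ∀ x₁ xmin : PISGD.Vec d, (∀ x, P.f xmin ≤ P.f x) → P.f x₁ - P.f xmin = Δ →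
      ∀ γ ε₁ ε₂ : ℝ, 0 < γ → γ < 1 → 0 < ε₁ → ε₁ ≤ 1 → 0 < ε₂ → ε₂ ≤ 1 →
      ∀ D : PISGD.Draws d p (PISGD.settings d c φ L₀ Q Δ γ ε₁ ε₂),
        (PISGD.totalCalls P.G x₁ D : ℝ) ≤
          M * PISGD.rate γ ε₁ ε₂ * Real.log (PISGD.rate γ ε₁ ε₂) ^ k) := by
  refine ⟨?_, fun L₀ Q Δ hL => ?_⟩
  · intro p P hL x₁ xmin hmin γ ε₁ ε₂ hγ₀ _ hε₁ hε₂ m hm Ω _ μ _ D hD xstar hx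
    exact PISGD.exists_event_isStationary hc₀ hc₁ hφ hd P hL hmin hγ₀ hε₁ hε₂ hm μ hD hx
  · obtain ⟨M, hM⟩ := PISGD.exists_totalCalls_le hc₀ hc₁ hφ d L₀ Q Δ hL
    -- One logarithm comes from the number of runs, the other from the same number inside ψ, and
    -- hence inside `T`.
    refine ⟨2, M, ?_⟩
    rintro p P hPL rfl x₁ xmin hmin rfl γ ε₁ ε₂ hγ₀ hγ₁ hε₁ hε₁' hε₂ hε₂' D
    have hQ : 0 < P.Q := lt_of_lt_of_le (by rw [hPL]; positivity) P.L₀_sq_le_Q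
    exact hM hQ (sub_nonneg.2 (hmin x₁)) p P.G x₁ γ ε₁ ε₂ hγ₀ hγ₁ hε₁ hε₁' hε₂ hε₂' D
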